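/- Let $\delta\neq0$ be a constant and consider the damped equation $$\ddot Y+g(Y)\dot Y-\frac{\delta}{Y^5}=0,\qquad h(Y)=-\frac{\delta}{Y^5}.\tag{E}$$ **(1) Chiellini condition (real $\delta$).** Let $J\subset\mathbb R\setminus\{0\}$ be an open interval and let $g$ be a function without zeros on $J$ that satisfies the Chiellini condition $\frac{d}{dY}\left(\frac{h}{g}\right)=-2g$ on $J$. Then there are a constant $c\in\mathbb R$ and a sign $\varepsilon\in\{1,-1\}$ such that on $J$ $$cY^4-\delta>0,\qquad \frac{h(Y)}{g(Y)}=\varepsilon\sqrt{c-\delta Y^{-4}},\qquad g(Y)=-\frac{\varepsilon\,\delta}{Y^3\sqrt{cY^4-\delta}}.$$ Conversely, for all $c\in\mathbb R$ and $\varepsilon=\pm1$ this $g$ satisfies the condition wherever $Y\ne0$ and $cY^4>\delta$, and every real function $Y$ on an open set of times with $Y\neq0$, $cY^4>\delta$ and $\dot Y=\varepsilon\sqrt{c-\delta Y^{-4}}$ solves (E) with this $g$. (The choice $\varepsilon=1$ gives $\dot Y=\sqrt{c-\delta Y^{-4}}$ and $g=-\delta/(Y^3\sqrt{cY^4-\delta})$.)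 **(2) The elliptic functions.** Let $c,\delta,y_0\in\mathbb C$, $\delta\ne0$, put $f(Y)=cY^4-\delta$ and let $f(y_0)=0$. Put $\alpha_0=c$, $\alpha_1=cy_0$, $\alpha_2=cy_0^2$, $\alpha_3=cy_0^3$ and $$g_2=3\alpha_2^2-4\alpha_1\alpha_3,\qquad g_3=2\alpha_1\alpha_2\alpha_3-\alpha_2^3-\alpha_0\alpha_3^2 .$$ There is a period lattice $L\subset\mathbb C$ with Weierstrass invariants $g_2,g_3$. For every such $L$, with its Weierstrass functions $\wp,\zeta,\sigma$, there is $\omega_0\notin L$ with $\wp(\omega_0)=f''(y_0)/24$. **(3) Parametric solution.** Let $L$ and $\omega_0$ be any such lattice and point, and let $\hat c,\hat\delta\in\mathbb C$ be arbitrary constants. For parameters $\omega$ with $\omega+\hat c,\ \omega+\hat c\pm\omega_0\notin L$, and with a continuous branch of the logarithm, set $$Y(\omega)=y_0+\frac{f'(y_0)}{4\left[\wp(\omega+\hat c)-\frac{f''(y_0)}{24}\right]},$$ $$\begin{aligned}t(\omega)={}&y_0^2\,\omega+\left[-\frac{y_0f'(y_0)}{2\wp'(\omega_0)}+\frac{f'(y_0)^2\wp''(\omega_0)}{16\,\wp'(\omega_0)^3}\right]\log\frac{\sigma(\omega+\hat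 c+\omega_0)}{\sigma(\omega+\hat c-\omega_0)}\\&-\frac{f'(y_0)^2}{16\,\wp'(\omega_0)^2}\left[\zeta(\omega+\hat c+\omega_0)+\zeta(\omega+\hat c-\omega_0)\right]\\&+(\omega+\hat c)\left(\frac{y_0f'(y_0)}{\wp'(\omega_0)}\zeta(\omega_0)-\frac{f'(y_0)^2}{16}\left[\frac{2\wp(\omega_0)}{\wp'(\omega_0)^2}+\frac{2\wp''(\omega_0)\zeta(\omega_0)}{\wp'(\omega_0)^3}\right]\right)+\hat\delta .\end{aligned}$$ Suppose this branch is defined on an open set of complex parameters. Then near every $\omega_1$ in this set with $Y(\omega_1)\ne0$ and $f(Y(\omega_1))\neq0$, the curve $(t(\omega),Y(\omega))$ is the graph of a holomorphic function $Y(t)$ which satisfies $\dot Y^2=c-\delta Y^{-4}$ and $\dot Y=r(Y)/Y^2$, and solves (E) with $g(Y)=-\delta/(Y^3r(Y))$, where $r$ is a holomorphic branch of $\sqrt{cY^4-\delta}$ near $Y(\omega_1)$; this $g$ satisfies the Chiellini condition $\frac{d}{dY}(h/g)=-2g$. **(4) Real solutions.** Let in addition $c,\delta$ be real ($y_0$,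 $\omega_0$, $\hat c$, $\hat\delta$ may be complex). If on an open interval $I$ of real parameters (with a continuous branch of the logarithm along $I$) $t(\omega)$ and $Y(\omega)$ are real, $Y(\omega)\neq0$ and $cY(\omega)^4\neq\delta$, then $t$ is strictly increasing on $I$ with open image, and for a sign $\varepsilon=\pm1$ the resulting function $Y(t)$ satisfies $cY^4>\delta$ and $\dot Y=\varepsilon\sqrt{c-\delta Y^{-4}}$, and solves (E) with $g(Y)=-\varepsilon\delta/(Y^3\sqrt{cY^4-\delta})$. Conversely, every real function $Y$ on an open time interval with $Y\ne0$, $cY^4>\delta$ and $\dot Y=\varepsilon\sqrt{c-\delta Y^{-4}}$ ($\varepsilon=\pm1$) arises in this way, with the given $L$ and $\omega_0$, for some $\hat c,\hat\delta\in\mathbb C$, some open interval of real parameters and some branch of the logarithm. -/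

import Mathlib

namespace MilnePinney

section Damped

variable {𝕜 : Type*} [NontriviallyNormedField 𝕜]

/-- The restoring term `h(Y) = -δ / Y⁵`. -/
def restoring (δ Y : 𝕜) : 𝕜 := -δ / Y ^ 5

/-- The damping `-δ / (Y³ √(cY⁴ - δ))`, where `r` is the chosen branch of `√(cY⁴ - δ)`. -/
def damping (δ : 𝕜) (r : 𝕜 → 𝕜) (Y : 𝕜) : 𝕜 := -δ / (Y ^ 3 * r Y)

/-- The Chiellini condition `d/dY (h / g) = p g` on the set `J`, where `g` has no zeros. -/
def ChielliniOn (p : 𝕜) (g h : 𝕜 → 𝕜) (J : Set 𝕜) : Prop :=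
  ∀ Y ∈ J, g Y ≠ 0 ∧ HasDerivAt (fun x => h x / g x) (p * g Y) Y

/-- `y` is twice differentiable at time `t` and satisfies `ÿ + g(y) ẏ - δ / y⁵ = 0` there. -/
def SolvesDampedAt (δ : 𝕜) (g : 𝕜 → 𝕜) (y : 𝕜 → 𝕜) (t : 𝕜) : Prop :=
  DifferentiableAt 𝕜 y t ∧ DifferentiableAt 𝕜 (deriv y) t ∧
    deriv (deriv y) t + g (y t) * deriv y t + restoring δ (y t) = 0

end Damped

noncomputable section Elliptic

/-- The Weierstrass zeta function `1/z + ∑_{l ≠ 0} (1/(z - l) + 1/l + z/l²)`.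
The term `l = 0` of the sum below is `1/z`, because `1/0 = 0`. -/
def weierstrassZeta (L : PeriodPair) (z : ℂ) : ℂ :=
  ∑' l : L.lattice, (1 / (z - l) + 1 / (l : ℂ) + z / (l : ℂ) ^ 2)

/-- The Weierstrass sigma function `z ∏_{l ≠ 0} (1 - z/l) exp (z/l + z²/(2l²))`.
The factor `l = 0` of the product below is `1`, because `z/0 = 0`. -/
def weierstrassSigma (L : PeriodPair) (z : ℂ) : ℂ :=
  z * ∏' l : L.lattice,
    ((1 - z / (l : ℂ)) * Complex.exp (z / (l : ℂ) + z ^ 2 / (2 * (l : ℂ) ^ 2)))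

/-- The quartic `f(Y) = cY⁴ - δ`. -/
def quartic (c δ Y : ℂ) : ℂ := c * Y ^ 4 - δ

/-- `g₂ = 3α₂² - 4α₁α₃` with `α₁ = cy₀`, `α₂ = cy₀²`, `α₃ = cy₀³`. -/
def invariantTwo (c y₀ : ℂ) : ℂ :=
  3 * (c * y₀ ^ 2) ^ 2 - 4 * (c * y₀) * (c * y₀ ^ 3)

/-- `g₃ = 2α₁α₂α₃ - α₂³ - α₀α₃²` with `α₀ = c`, `α₁ = cy₀`, `α₂ = cy₀²`, `α₃ = cy₀³`. -/
def invariantThree (c y₀ : ℂ) : ℂ :=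
  2 * (c * y₀) * (c * y₀ ^ 2) * (c * y₀ ^ 3) - (c * y₀ ^ 2) ^ 3 - c * (c * y₀ ^ 3) ^ 2

/-- `L` is a period lattice of `℘(·; g₂, g₃)` for the invariants above. -/
def HasInvariants (L : PeriodPair) (c y₀ : ℂ) : Prop :=
  L.g₂ = invariantTwo c y₀ ∧ L.g₃ = invariantThree c y₀

/-- `ω₀` is a point with `℘(ω₀) = f''(y₀) / 24`. -/
def IsBasePoint (L : PeriodPair) (c δ y₀ ω₀ : ℂ) : Prop :=
  ω₀ ∉ L.lattice ∧ L.weierstrassP ω₀ = deriv (deriv (quartic c δ)) y₀ / 24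

/-- `Y` as a function of the parameter `ω`; `C` is the shift of the parameter. -/
def paramY (L : PeriodPair) (c δ y₀ C ω : ℂ) : ℂ :=
  y₀ + deriv (quartic c δ) y₀ /
    (4 * (L.weierstrassP (ω + C) - deriv (deriv (quartic c δ)) y₀ / 24))

/-- `t` as a function of the parameter `ω`; `C` is the shift of the parameter, `D` the additive
integration constant and `ℓ` the chosen value of `log (σ(ω + C + ω₀) / σ(ω + C - ω₀))`. -/
def paramT (L : PeriodPair) (c δ y₀ ω₀ C D ℓ ω : ℂ) : ℂ :=
  let f' := deriv (quartic c δ) y₀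
  let P := L.weierstrassP ω₀
  let P' := L.derivWeierstrassP ω₀
  let P'' := deriv L.derivWeierstrassP ω₀
  let Z := weierstrassZeta L
  y₀ ^ 2 * ω
    + (-(y₀ * f') / (2 * P') + f' ^ 2 * P'' / (16 * P' ^ 3)) * ℓ
    - f' ^ 2 / (16 * P' ^ 2) * (Z (ω + C + ω₀) + Z (ω + C - ω₀))
    + (ω + C) * (y₀ * f' / P' * Z ω₀
        - f' ^ 2 / 16 * (2 * P / P' ^ 2 + 2 * P'' * Z ω₀ / P' ^ 3))
    + D

/-- The parameter `ω` avoids the singularities of the parametric formulas, and `ℓ` is a value of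
`log (σ(ω + C + ω₀) / σ(ω + C - ω₀))`. -/
def IsLogValue (L : PeriodPair) (ω₀ C ω ℓ : ℂ) : Prop :=
  ω + C ∉ L.lattice ∧ ω + C + ω₀ ∉ L.lattice ∧ ω + C - ω₀ ∉ L.lattice ∧
    Complex.exp ℓ = weierstrassSigma L (ω + C + ω₀) / weierstrassSigma L (ω + C - ω₀)

/-- On the set `I` of real parameters the formulas, with a continuous branch `Λ` of the logarithm,
take the real values `τ ω` (time) and `η ω` (position). -/
def IsRealCurve (L : PeriodPair) (c δ y₀ ω₀ C D : ℂ) (I : Set ℝ) (Λ : ℝ → ℂ) (τ η : ℝ → ℝ) :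
    Prop :=
  ContinuousOn Λ I ∧ ∀ ω ∈ I, IsLogValue L ω₀ C ω (Λ ω) ∧
    (τ ω : ℂ) = paramT L c δ y₀ ω₀ C D (Λ ω) ω ∧ (η ω : ℂ) = paramY L c δ y₀ C ω

end Elliptic

end MilnePinney

/-! Put `f = quartic c δ`. Everything reduces to `Ẏ² = f(Y)/Y⁴`. For `u = h/g` the Chiellini
condition gives `u u' = -2h`, so `u² + δ/Y⁴` is constant; conversely, differentiating `Ẏ = r(Y)/Y²`
with `r² = f` yields the damped equation. In the parameter with `dω = dt/Y²` the first-order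
equation becomes `(dY/dω)² = f(Y)`. Since `y₀` is a root of `f`, the Möbius substitution in `paramY`
corresponds to moving `y₀` to infinity and turns the quartic into the Weierstrass cubic with `g₂ =
-c²y₀⁴` and `g₃ = 0`. A rescaled square lattice realizes these invariants.

Time is the integral of `Y²`, a quadratic polynomial in `1/(℘(u) - ℘(ω₀))`. The expansion of this
function in zeta functions (`zetaBracket_mul`) and its derivative in the second point
(`zetaBracket_deriv_mul`) handle the linear and the quadratic term; `ζ' = -℘` and `σ'/σ = ζ` then
integrate them to `paramT`. The expansion rests on Liouville's theorem for elliptic functions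
(`eventuallyEq_const_of_periodic`), which also shows that `℘` takes every value.

As `dt/dω = Y² ≠ 0`, the inverse function theorem makes the curve a graph over time. In the
converse, the inverse Möbius map sends a reparametrized real solution to a solution of `p'' = 6p² -
g₂/2`. Surjectivity and evenness of `℘` match the initial data, and ODE uniqueness with a
connectedness argument identifies `p` with `℘(ω + C)` on the whole interval. The branch of the
logarithm and the constant `D` come from integration. -/

open Filter Topology

/-! ### Liouville's theorem for elliptic functions and its consequences for `℘`. -/

namespace PeriodPair

variable (L : PeriodPair)

/-- A meromorphic function with a lattice of periods and without poles is constant. -/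
theorem eventuallyEq_const_of_periodic {f : ℂ → ℂ} (hf : Meromorphic f)
    (hper : ∀ l ∈ L.lattice, ∀ z, ∀ᶠ w in 𝓝[≠] z, f (w + l) = f w)
    (hlim : ∀ z, ∃ c, Tendsto f (𝓝[≠] z) (𝓝 c)) :
    ∃ c, ∀ z, f =ᶠ[𝓝[≠] z] fun _ => c := by
  have hf' : MeromorphicOn f Set.univ := fun z _ => hf z
  -- The normal form fills in the removable singularities, so `F` is entire, truly periodic and
  -- hence bounded.
  set F := toMeromorphicNFOn f Set.univ with hF
  have hfF : ∀ z, f =ᶠ[𝓝[≠] z] F := fun z =>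
    (hf'.toMeromorphicNFOn_eq_self_on_nhdsNE (Set.mem_univ z)).symm
  have han : ∀ z, AnalyticAt ℂ F z := by
    intro z
    have h := meromorphicNFOn_toMeromorphicNFOn f Set.univ (Set.mem_univ z)
    rw [← h.meromorphicOrderAt_nonneg_iff_analyticAt,
      meromorphicOrderAt_toMeromorphicNFOn hf' (Set.mem_univ z)]
    exact (tendsto_nhds_iff_meromorphicOrderAt_nonneg (hf z)).1 (hlim z)
  have hFper : ∀ z, ∀ l ∈ L.lattice, F (z + l) = F z := by
    intro z l hl
    have hlim : Tendsto (· + l) (𝓝[≠] z) (𝓝[≠] (z + l)) := by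
      refine tendsto_nhdsWithin_iff.2 ⟨?_, ?_⟩
      · exact ((continuous_add_const l).tendsto z).mono_left nhdsWithin_le_nhds
      · filter_upwards [self_mem_nhdsWithin] with w hw
        simpa using hw
    have h1 : Tendsto (fun w => F (w + l)) (𝓝[≠] z) (𝓝 (F (z + l))) :=
      ((han (z + l)).continuousAt.tendsto.mono_left nhdsWithin_le_nhds).comp hlim
    have h2 : Tendsto F (𝓝[≠] z) (𝓝 (F z)) :=
      (han z).continuousAt.tendsto.mono_left nhdsWithin_le_nhds
    refine tendsto_nhds_unique (h1.congr' ?_) h2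
    filter_upwards [hlim.eventually (hfF (z + l)), hfF z, hper l hl z] with w hw hw' hw''
    rw [← hw, ← hw', hw'']
  have hdiff : Differentiable ℂ F := fun z => (han z).differentiableAt
  refine ⟨F 0, fun z => (hfF z).trans (Eventually.of_forall fun w => ?_)⟩
  exact hdiff.apply_eq_apply_of_bounded (IsZLattice.isCompact_range_of_periodic L.lattice _
    hdiff.continuous fun z w hw => hFper z w hw).isBounded w 0

theorem eventually_notMem_lattice (z : ℂ) : ∀ᶠ w in 𝓝[≠] z, w ∉ L.lattice := by
  filter_upwards [self_mem_nhdsWithin, mem_nhdsWithin_of_mem_nhds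
    (L.compl_lattice_sdiff_singleton_mem_nhds z)] with w hw hw'
  simp_all

theorem isOpen_compl_lattice : IsOpen ((L.lattice : Set ℂ)ᶜ) := L.isClosed_lattice.isOpen_compl

theorem hasDerivAt_weierstrassP {z : ℂ} (hz : z ∉ L.lattice) :
    HasDerivAt L.weierstrassP (L.derivWeierstrassP z) z := by
  rw [← L.deriv_weierstrassP]
  exact (L.differentiableOn_weierstrassP.differentiableAt
    (L.isOpen_compl_lattice.mem_nhds hz)).hasDerivAt

theorem hasDerivAt_derivWeierstrassP {z : ℂ} (hz : z ∉ L.lattice) :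
    HasDerivAt L.derivWeierstrassP (deriv L.derivWeierstrassP z) z :=
  (L.differentiableOn_derivWeierstrassP.differentiableAt
    (L.isOpen_compl_lattice.mem_nhds hz)).hasDerivAt

theorem tendsto_weierstrassP_cobounded {l : ℂ} (hl : l ∈ L.lattice) :
    Tendsto L.weierstrassP (𝓝[≠] l) (Bornology.cobounded ℂ) := by
  apply tendsto_cobounded_of_meromorphicOrderAt_neg
  rw [L.order_weierstrassP l hl]
  decide

/-- The Weierstrass function takes every value. -/
theorem exists_weierstrassP_eq (a : ℂ) : ∃ z, z ∉ L.lattice ∧ L.weierstrassP z = a := by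
  -- If `a` were omitted, `1/(℘ - a)` would have no poles and tend to `0` at the lattice points, so
  -- it would be the constant `0`.
  by_contra! H
  have hmer : Meromorphic fun z => (L.weierstrassP z - a)⁻¹ := by
    have := L.meromorphic_weierstrassP
    fun_prop
  have htend : ∀ l ∈ L.lattice, Tendsto (fun z => (L.weierstrassP z - a)⁻¹) (𝓝[≠] l) (𝓝 0) := by
    intro l hl
    refine tendsto_inv₀_cobounded.comp ?_
    simpa [sub_eq_add_neg] using! (tendsto_add_const_cobounded (-a)).comp
      (L.tendsto_weierstrassP_cobounded hl)
  obtain ⟨c, hc⟩ := L.eventuallyEq_const_of_periodic hmer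
    (fun l hl z => Eventually.of_forall fun w => by rw [L.weierstrassP_add_coe w ⟨l, hl⟩]) (by
      intro z
      by_cases hz : z ∈ L.lattice
      · exact ⟨0, htend z hz⟩
      · refine ⟨(L.weierstrassP z - a)⁻¹, ?_⟩
        exact (((L.hasDerivAt_weierstrassP hz).continuousAt.sub continuousAt_const).inv₀
          (sub_ne_zero.2 (H z hz))).tendsto.mono_left nhdsWithin_le_nhds)
  have h0 : c = 0 := tendsto_nhds_unique
    (tendsto_const_nhds.congr' (hc 0).symm) (htend 0 (zero_mem _))
  obtain ⟨w, hw, hw'⟩ := ((hc 0).and (L.eventually_notMem_lattice 0)).exists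
  rw [h0, inv_eq_zero, sub_eq_zero] at hw
  exact H w hw' hw

theorem isPreconnected_compl_lattice : IsPreconnected ((L.lattice : Set ℂ)ᶜ) :=
  (Set.Countable.isConnected_compl_of_one_lt_rank (by simp)
    (countable_of_Lindelof_of_discrete (X := L.lattice))).2

/-- The second derivative of the Weierstrass function. -/
theorem deriv_derivWeierstrassP {z : ℂ} (hz : z ∉ L.lattice) :
    deriv L.derivWeierstrassP z = 6 * L.weierstrassP z ^ 2 - L.g₂ / 2 := by
  have hana := L.analyticOnNhd_derivWeierstrassP
  have hanp := L.analyticOnNhd_weierstrassP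
  -- Differentiating the cubic relation leaves a factor `℘'`. On the connected complement of the
  -- lattice one analytic factor must vanish identically, and it is not `℘'` because `℘` is not
  -- constant.
  have hprod : ∀ w ∈ (L.lattice : Set ℂ)ᶜ, L.derivWeierstrassP w *
      (deriv L.derivWeierstrassP w - (6 * L.weierstrassP w ^ 2 - L.g₂ / 2)) = 0 := by
    intro w hw
    have h1 : HasDerivAt (fun z => L.derivWeierstrassP z ^ 2) _ w :=
      (L.hasDerivAt_derivWeierstrassP hw).pow 2
    have h2 := ((((L.hasDerivAt_weierstrassP hw).pow 3).const_mul 4).sub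
      ((L.hasDerivAt_weierstrassP hw).const_mul L.g₂)).sub_const L.g₃
    have h3 := h1.unique (h2.congr_of_eventuallyEq (by
      filter_upwards [L.isOpen_compl_lattice.mem_nhds hw] with x hx
      exact L.derivWeierstrassP_sq x hx))
    simp only [Nat.cast_ofNat] at h3
    linear_combination h3 / 2
  have hor := AnalyticOnNhd.eq_zero_or_eq_zero_of_mul_eq_zero hana
    (hana.deriv.sub (((analyticOnNhd_const (v := (6 : ℂ))).mul (hanp.pow 2)).sub
      (analyticOnNhd_const (v := L.g₂ / 2)))) hprod L.isPreconnected_compl_lattice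
  rcases hor with h | h
  · exfalso
    obtain ⟨a, ha, ha'⟩ := L.exists_weierstrassP_eq 0
    obtain ⟨b, hb, hb'⟩ := L.exists_weierstrassP_eq 1
    have := L.isOpen_compl_lattice.is_const_of_deriv_eq_zero L.isPreconnected_compl_lattice
      L.differentiableOn_weierstrassP (fun w hw => by rw [L.deriv_weierstrassP]; exact h w hw)
      ha hb
    rw [ha', hb'] at this
    exact zero_ne_one this
  · exact sub_eq_zero.1 (h z hz)

end PeriodPair

/-! ### The Weierstrass zeta function: convergence, derivative, poles, quasi-periodicity. -/

namespace MilnePinney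

variable (L : PeriodPair)

/-- The Weierstrass zeta function without the term of the lattice point `l₀`. -/
noncomputable def zetaExcept (l₀ z : ℂ) : ℂ :=
  ∑' l : L.lattice, if (l : ℂ) = l₀ then 0 else 1 / (z - l) + 1 / (l : ℂ) + z / (l : ℂ) ^ 2

/-- The three summands combine to `z²/((z - l) l²)`, and `‖z - l‖ ≥ ‖l‖/2`. The exponent `-3` is
summable over a lattice of rank two. -/
theorem zeta_term_bound {r : ℝ} (hr : 0 < r) {z l : ℂ} (hz : ‖z‖ < r) (h : 2 * r ≤ ‖l‖) :
    ‖1 / (z - l) + 1 / l + z / l ^ 2‖ ≤ 2 * r ^ 2 * ‖l‖ ^ (-3 : ℝ) := by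
  have hl : 0 < ‖l‖ := by linarith
  have hl0 : l ≠ 0 := norm_pos_iff.1 hl
  have hzl : ‖l‖ / 2 ≤ ‖z - l‖ := by
    rw [norm_sub_rev]
    exact .trans (by linarith) (norm_sub_norm_le l z)
  have hzl0 : z - l ≠ 0 := norm_pos_iff.1 (by linarith)
  have e : 1 / (z - l) + 1 / l + z / l ^ 2 = z ^ 2 / ((z - l) * l ^ 2) := by
    field_simp
    ring
  have e2 : ‖l‖ ^ (-3 : ℝ) = (‖l‖ ^ 3)⁻¹ := by norm_cast
  rw [e, e2, norm_div, norm_mul, norm_pow, norm_pow]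
  calc ‖z‖ ^ 2 / (‖z - l‖ * ‖l‖ ^ 2) ≤ r ^ 2 / (‖l‖ / 2 * ‖l‖ ^ 2) := by gcongr
    _ = _ := by field_simp

theorem hasSumLocallyUniformly_zetaExcept (l₀ : ℂ) :
    HasSumLocallyUniformly (fun (l : L.lattice) (z : ℂ) =>
      if (l : ℂ) = l₀ then 0 else 1 / (z - l) + 1 / (l : ℂ) + z / (l : ℂ) ^ 2)
      (zetaExcept L l₀) := by
  refine L.hasSumLocallyUniformly_aux (u := fun r l => 2 * r ^ 2 * ‖l‖ ^ (-3 : ℝ)) _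
    (fun r _ => (ZLattice.summable_norm_rpow _ _ (by simp; norm_num)).mul_left _) fun r hr =>
    Filter.eventually_atTop.mpr ⟨2 * r, ?_⟩
  rintro _ h s hs l rfl
  split_ifs
  · rw [norm_zero]; positivity
  · exact zeta_term_bound hr hs h

theorem hasDerivAt_zeta_term {z l : ℂ} (h : z ≠ l) :
    HasDerivAt (fun z => 1 / (z - l) + 1 / l + z / l ^ 2) (-(1 / (z - l) ^ 2 - 1 / l ^ 2)) z := by
  have h' := sub_ne_zero.2 h
  have h1 := (((hasDerivAt_id z).sub_const l).inv h').add_const (1 / l)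
  have h2 := h1.add ((hasDerivAt_id z).div_const (l ^ 2))
  refine (h2.congr_deriv ?_).congr_of_eventuallyEq (Eventually.of_forall fun w => ?_)
  · simp only [id]; ring
  · simp

/-- Termwise differentiation, justified by locally uniform convergence of the differentiated sums.
Leaving out the term of `l₀` makes `l₀` a regular point, which gives the local behaviour of zeta at
its poles. -/
theorem hasDerivAt_zetaExcept (l₀ : ℂ) {z : ℂ} (hz : z ∈ ((L.lattice : Set ℂ) \ {l₀})ᶜ) :
    HasDerivAt (zetaExcept L l₀) (-L.weierstrassPExcept l₀ z) z := by
  have hopen := L.isOpen_compl_lattice_sdiff (s := {l₀})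
  have hd : ∀ l : L.lattice, ∀ w ∈ ((L.lattice : Set ℂ) \ {l₀})ᶜ, HasDerivAt (fun z : ℂ =>
      if (l : ℂ) = l₀ then 0 else 1 / (z - l) + 1 / (l : ℂ) + z / (l : ℂ) ^ 2)
      (-(if (l : ℂ) = l₀ then 0 else 1 / (w - l) ^ 2 - 1 / (l : ℂ) ^ 2)) w := by
    intro l w hw
    split_ifs with h
    · simpa using hasDerivAt_const w (0 : ℂ)
    · refine hasDerivAt_zeta_term fun e => h ?_
      subst e
      simpa using hw
  have hts : ∀ s : Finset L.lattice, ∀ w ∈ ((L.lattice : Set ℂ) \ {l₀})ᶜ, HasDerivAt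
      (fun z : ℂ => ∑ l ∈ s,
        if (l : ℂ) = l₀ then 0 else 1 / (z - l) + 1 / (l : ℂ) + z / (l : ℂ) ^ 2)
      (-∑ l ∈ s, if (l : ℂ) = l₀ then 0 else 1 / (w - l) ^ 2 - 1 / (l : ℂ) ^ 2) w := by
    intro s w hw
    rw [← Finset.sum_neg_distrib]
    exact HasDerivAt.fun_sum fun l _ => hd l w hw
  refine hasDerivAt_of_tendstoLocallyUniformlyOn hopen
    (f' := fun (s : Finset L.lattice) w =>
      -∑ l ∈ s, if (l : ℂ) = l₀ then 0 else 1 / (w - l) ^ 2 - 1 / (l : ℂ) ^ 2)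
    (g' := fun w => -L.weierstrassPExcept l₀ w) (l := atTop) ?_
    (Eventually.of_forall hts) (fun w hw => ?_) hz
  · have h := (L.hasSumLocallyUniformly_weierstrassPExcept l₀).tendstoLocallyUniformlyOn
      (s := ((L.lattice : Set ℂ) \ {l₀})ᶜ)
    exact h.neg
  · exact (hasSumLocallyUniformly_zetaExcept L l₀).tendstoLocallyUniformlyOn.tendsto_at
      (Set.mem_univ w)

theorem zetaExcept_of_notMem {l₀ : ℂ} (h : l₀ ∉ L.lattice) :
    zetaExcept L l₀ = weierstrassZeta L := by
  ext z
  refine tsum_congr fun l => if_neg ?_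
  rintro rfl
  exact h l.2

theorem hasDerivAt_zeta {z : ℂ} (hz : z ∉ L.lattice) :
    HasDerivAt (weierstrassZeta L) (-L.weierstrassP z) z := by
  -- A half period is not a lattice point, so no term is omitted.
  have h := hasDerivAt_zetaExcept L (L.ω₁ / 2) (z := z) (by simp [hz])
  rwa [zetaExcept_of_notMem L L.ω₁_div_two_notMem_lattice,
    L.weierstrassPExcept_of_notMem _ L.ω₁_div_two_notMem_lattice] at h

theorem zetaExcept_add {l₀ : ℂ} (h : l₀ ∈ L.lattice) (z : ℂ) :
    zetaExcept L l₀ z + (1 / (z - l₀) + 1 / l₀ + z / l₀ ^ 2) = weierstrassZeta L z := by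
  have h1 := ((hasSumLocallyUniformly_zetaExcept L l₀).tendstoLocallyUniformlyOn.tendsto_at
      (Set.mem_univ z))
  have h2 : HasSum (fun l : L.lattice => if (l : ℂ) = l₀ then 0 else
    1 / (z - l) + 1 / (l : ℂ) + z / (l : ℂ) ^ 2) (zetaExcept L l₀ z) := h1
  have h3 := h2.add (hasSum_ite_eq (⟨l₀, h⟩ : L.lattice) (1 / (z - l₀) + 1 / l₀ + z / l₀ ^ 2))
  refine (h3.tsum_eq.symm.trans (tsum_congr fun l => ?_))
  by_cases hl : (l : ℂ) = l₀
  · have : l = ⟨l₀, h⟩ := Subtype.ext hl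
    subst this
    simp
  · have : l ≠ ⟨l₀, h⟩ := fun e => hl (congrArg Subtype.val e)
    simp [hl, this]

theorem weierstrassZeta_neg (z : ℂ) : weierstrassZeta L (-z) = -weierstrassZeta L z := by
  unfold weierstrassZeta
  rw [← (Equiv.neg L.lattice).tsum_eq, ← tsum_neg]
  refine tsum_congr fun l => ?_
  have : -z - ((Equiv.neg L.lattice) l : ℂ) = -(z - l) := by simp; ring
  rw [this, one_div_neg_eq_neg_one_div]
  simp only [Equiv.neg_apply, NegMemClass.coe_neg, one_div_neg_eq_neg_one_div, even_two,
    Even.neg_pow, neg_div]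
  ring

theorem meromorphic_zeta : Meromorphic (weierstrassZeta L) := by
  intro z
  by_cases hz : z ∈ L.lattice
  · have h : AnalyticAt ℂ (zetaExcept L z) z := by
      refine DifferentiableOn.analyticAt (s := ((L.lattice : Set ℂ) \ {z})ᶜ) (fun w hw => ?_)
        (L.compl_lattice_sdiff_singleton_mem_nhds z)
      exact (hasDerivAt_zetaExcept L z hw).differentiableAt.differentiableWithinAt
    have := h.meromorphicAt
    rw [← funext (zetaExcept_add L hz)]
    fun_prop
  · refine (DifferentiableOn.analyticAt (s := (L.lattice : Set ℂ)ᶜ) (fun w hw => ?_)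
      (L.isOpen_compl_lattice.mem_nhds hz)).meromorphicAt
    exact (hasDerivAt_zeta L hw).differentiableAt.differentiableWithinAt

/-- Apart from `1/(z - l)` the series is holomorphic at `l`, so the pole is simple with residue `1`.
-/
theorem tendsto_sub_mul_zeta {l : ℂ} (hl : l ∈ L.lattice) :
    Tendsto (fun z => (z - l) * weierstrassZeta L z) (𝓝[≠] l) (𝓝 1) := by
  have h1 : ContinuousAt (fun z => (z - l) * (zetaExcept L l z + 1 / l + z / l ^ 2) + 1) l := by
    have := (hasDerivAt_zetaExcept L l (z := l) (by simp)).continuousAt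
    fun_prop
  have h2 := h1.tendsto.mono_left (nhdsWithin_le_nhds (s := {l}ᶜ))
  simp only [sub_self, zero_mul, zero_add] at h2
  refine h2.congr' ?_
  filter_upwards [self_mem_nhdsWithin] with z hz
  have : z - l ≠ 0 := sub_ne_zero.2 hz
  rw [← zetaExcept_add L hl, one_div (z - l)]
  linear_combination -(mul_inv_cancel₀ this)

/-- The zeta function is quasi-periodic. -/
theorem zeta_add_sub_zeta {l : ℂ} (hl : l ∈ L.lattice) {z w : ℂ} (hz : z ∉ L.lattice)
    (hw : w ∉ L.lattice) :
    weierstrassZeta L (z + l) - weierstrassZeta L z =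
      weierstrassZeta L (w + l) - weierstrassZeta L w := by
  -- Periodicity of `℘` kills the derivative of the increment, and the complement of the lattice is
  -- connected.
  have hd : ∀ x ∈ (L.lattice : Set ℂ)ᶜ, HasDerivAt
      (fun x => weierstrassZeta L (x + l) - weierstrassZeta L x) 0 x := by
    intro x hx
    have hxl : x + l ∉ L.lattice := fun h => hx (by simpa using sub_mem h hl)
    have h1 := (hasDerivAt_zeta L hxl).comp_add_const x l
    refine (h1.sub (hasDerivAt_zeta L hx)).congr_deriv ?_
    rw [L.weierstrassP_add_coe x ⟨l, hl⟩]
    ring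
  exact L.isOpen_compl_lattice.is_const_of_deriv_eq_zero L.isPreconnected_compl_lattice
    (fun x hx => (hd x hx).differentiableAt.differentiableWithinAt)
    (fun x hx => (hd x hx).deriv) hz hw

end MilnePinney

/-! ### Partial fractions of `1/(℘(u) - ℘(v))`. -/

namespace PeriodPair

variable (L : PeriodPair)

theorem eventually_add_notMem_lattice (z v : ℂ) : ∀ᶠ w in 𝓝[≠] z, w + v ∉ L.lattice := by
  have hlim : Tendsto (· + v) (𝓝[≠] z) (𝓝[≠] (z + v)) := by
    refine tendsto_nhdsWithin_iff.2 ⟨?_, ?_⟩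
    · exact ((continuous_add_const v).tendsto z).mono_left nhdsWithin_le_nhds
    · filter_upwards [self_mem_nhdsWithin] with w hw
      simpa using hw
  exact hlim.eventually (L.eventually_notMem_lattice (z + v))

theorem tendsto_sub_sq_mul_weierstrassP {l : ℂ} (hl : l ∈ L.lattice) :
    Tendsto (fun z => (z - l) ^ 2 * L.weierstrassP z) (𝓝[≠] l) (𝓝 1) := by
  have h1 : ContinuousAt
      (fun z => (z - l) ^ 2 * L.weierstrassPExcept l z + 1 - (z - l) ^ 2 / l ^ 2) l := by
    have := (L.analyticAt_weierstrassPExcept l).continuousAt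
    fun_prop
  have h2 := h1.tendsto.mono_left (nhdsWithin_le_nhds (s := {l}ᶜ))
  simp only [sub_self, ne_eq, OfNat.ofNat_ne_zero, not_false_eq_true, zero_pow, zero_mul, zero_div,
    zero_add, sub_zero] at h2
  refine h2.congr' ?_
  filter_upwards [self_mem_nhdsWithin] with z hz
  rw [← L.ite_eq_one_sub_sq_mul_weierstrassP l hl z, if_neg (by simpa using hz)]

end PeriodPair

namespace MilnePinney

variable (L : PeriodPair)

/-- The combination of zeta functions that is proportional to `1 / (℘ u - ℘ v)`. -/
noncomputable def zetaBracket (v u : ℂ) : ℂ :=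
  weierstrassZeta L (u - v) - weierstrassZeta L (u + v) + 2 * weierstrassZeta L v

theorem hasDerivAt_zetaBracket {u v : ℂ} (hm : u - v ∉ L.lattice) (hp : u + v ∉ L.lattice) :
    HasDerivAt (zetaBracket L v) (L.weierstrassP (u + v) - L.weierstrassP (u - v)) u := by
  have h := (((hasDerivAt_zeta L hm).comp_sub_const u v).sub
    ((hasDerivAt_zeta L hp).comp_add_const u v)).add_const (2 * weierstrassZeta L v)
  exact h.congr_deriv (by ring)

theorem hasDerivAt_zetaBracket_left {u v : ℂ} (hv : v ∉ L.lattice) (hm : u - v ∉ L.lattice)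
    (hp : u + v ∉ L.lattice) :
    HasDerivAt (fun v => zetaBracket L v u)
      (L.weierstrassP (u - v) + L.weierstrassP (u + v) - 2 * L.weierstrassP v) v := by
  have h := (((hasDerivAt_zeta L hm).comp_const_sub u v).sub
    ((hasDerivAt_zeta L hp).comp_const_add u v)).add ((hasDerivAt_zeta L hv).const_mul 2)
  exact h.congr_deriv (by ring)

/-- The quasi-period of `l` may be computed at `-v` or at `v`; since zeta is odd, the two results
differ by exactly the constant `2ζ(v)` of the bracket. -/
theorem zetaBracket_of_mem {v l : ℂ} (hv : v ∉ L.lattice) (hl : l ∈ L.lattice) :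
    zetaBracket L v l = 0 := by
  have h := zeta_add_sub_zeta L hl (z := -v) (w := v) (by simpa using hv) hv
  rw [weierstrassZeta_neg] at h
  rw [zetaBracket, sub_eq_neg_add l v, add_comm l v]
  linear_combination h

/-- The bracket vanishes to order two at `l`, its derivative being zero there because `℘` is even
and periodic. This cancels the double pole of `℘`. -/
theorem tendsto_zetaBracket_mul_at_lattice {v l : ℂ} (hv : v ∉ L.lattice) (hl : l ∈ L.lattice) :
    ∃ c, Tendsto (fun u => zetaBracket L v u * (L.weierstrassP u - L.weierstrassP v))
      (𝓝[≠] l) (𝓝 c) := by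
  have hmem : ∀ᶠ u in 𝓝 l, u - v ∉ L.lattice ∧ u + v ∉ L.lattice := by
    refine ((continuous_sub_right v).continuousAt.eventually
      (L.isOpen_compl_lattice.mem_nhds ?_)).and
      ((continuous_add_const v).continuousAt.eventually (L.isOpen_compl_lattice.mem_nhds ?_))
    · intro h; exact hv (by simpa using sub_mem hl h)
    · intro h; exact hv (by simpa using sub_mem h hl)
  have hd : ∀ᶠ u in 𝓝 l, HasDerivAt (zetaBracket L v)
      (L.weierstrassP (u + v) - L.weierstrassP (u - v)) u :=
    hmem.mono fun u hu => hasDerivAt_zetaBracket L hu.1 hu.2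
  have han : AnalyticAt ℂ (zetaBracket L v) l := by
    rw [Complex.analyticAt_iff_eventually_differentiableAt]
    exact hd.mono fun u hu => hu.differentiableAt
  have hord : (2 : ℕ) ≤ analyticOrderAt (zetaBracket L v) l := by
    rw [natCast_le_analyticOrderAt_iff_iteratedDeriv_eq_zero han]
    intro i hi
    interval_cases i
    · simpa using zetaBracket_of_mem L hv hl
    · rw [iteratedDeriv_one, hd.self_of_nhds.deriv, add_comm l v, L.weierstrassP_add_coe v ⟨l, hl⟩,
        ← neg_sub v l, L.weierstrassP_neg, L.weierstrassP_sub_coe v ⟨l, hl⟩, sub_self]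
  obtain ⟨g, hg, hg'⟩ := (natCast_le_analyticOrderAt han).1 hord
  refine ⟨g l * 1 - zetaBracket L v l * L.weierstrassP v, ?_⟩
  have h1 := (hg.continuousAt.tendsto.mono_left (nhdsWithin_le_nhds (s := {l}ᶜ))).mul
    (L.tendsto_sub_sq_mul_weierstrassP hl)
  have h2 := (han.continuousAt.tendsto.mono_left (nhdsWithin_le_nhds (s := {l}ᶜ))).mul_const
    (L.weierstrassP v)
  refine (h1.sub h2).congr' ?_
  filter_upwards [nhdsWithin_le_nhds hg'] with u hu
  rw [mul_sub, sub_left_inj]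
  rw [hu, smul_eq_mul]
  ring

/-- At a half period `℘'`, odd and periodic, equals its own negative. Thus `v` and `-v` are distinct
modulo the lattice, and the poles of the bracket do not collide. -/
theorem two_mul_notMem_of_derivWeierstrassP_ne_zero {v : ℂ} (hv' : L.derivWeierstrassP v ≠ 0) :
    2 * v ∉ L.lattice := by
  intro h
  have h1 := L.derivWeierstrassP_sub_coe v ⟨2 * v, h⟩
  have h2 : v - 2 * v = -v := by ring
  rw [h2, L.derivWeierstrassP_neg] at h1
  exact hv' (by linear_combination -h1 / 2)

/-- The simple pole of `ζ(u - v)` with residue `1` meets the simple zero of `℘(u) - ℘(v)` with slope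
`℘'(v)`. -/
theorem tendsto_zetaBracket_mul_at_pole {v l : ℂ} (hv : v ∉ L.lattice)
    (hv' : L.derivWeierstrassP v ≠ 0) (hl : l ∈ L.lattice) :
    Tendsto (fun u => zetaBracket L v u * (L.weierstrassP u - L.weierstrassP v))
      (𝓝[≠] (v + l)) (𝓝 (L.derivWeierstrassP v)) := by
  have hvl : v + l ∉ L.lattice := fun h => hv (by simpa using sub_mem h hl)
  have h2v := two_mul_notMem_of_derivWeierstrassP_ne_zero L hv'
  have hvlv : v + l + v ∉ L.lattice := fun h => h2v (by
    have := sub_mem h hl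
    rwa [show v + l + v - l = 2 * v by ring] at this)
  have hslope : Tendsto (fun u => (L.weierstrassP u - L.weierstrassP v) / (u - (v + l)))
      (𝓝[≠] (v + l)) (𝓝 (L.derivWeierstrassP v)) := by
    have h := (L.hasDerivAt_weierstrassP hvl).tendsto_slope
    rw [L.derivWeierstrassP_add_coe v ⟨l, hl⟩] at h
    refine h.congr fun u => ?_
    rw [slope_def_field, L.weierstrassP_add_coe v ⟨l, hl⟩]
  have hlim : Tendsto (· - v) (𝓝[≠] (v + l)) (𝓝[≠] l) := by
    refine tendsto_nhdsWithin_iff.2 ⟨?_, ?_⟩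
    · have := (continuous_sub_right v).tendsto (v + l)
      rw [add_sub_cancel_left] at this
      exact this.mono_left nhdsWithin_le_nhds
    · filter_upwards [self_mem_nhdsWithin] with w hw
      simpa [sub_eq_iff_eq_add'] using hw
  have hz := (tendsto_sub_mul_zeta L hl).comp hlim
  have hrest : ContinuousAt (fun u => (u - (v + l)) *
      (2 * weierstrassZeta L v - weierstrassZeta L (u + v))) (v + l) := by
    have := ((hasDerivAt_zeta L hvlv).comp_add_const (v + l) v).continuousAt
    fun_prop
  have hrest' := hrest.tendsto.mono_left (nhdsWithin_le_nhds (s := {v + l}ᶜ))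
  rw [sub_self, zero_mul] at hrest'
  have h := (hz.add hrest').mul hslope
  rw [add_zero, one_mul] at h
  refine h.congr' ?_
  filter_upwards [self_mem_nhdsWithin] with u hu
  have : u - (v + l) ≠ 0 := sub_ne_zero.2 hu
  simp only [Function.comp_apply, zetaBracket]
  field_simp
  ring

theorem zetaBracket_neg (v u : ℂ) : zetaBracket L (-v) u = -zetaBracket L v u := by
  simp only [zetaBracket, weierstrassZeta_neg, sub_neg_eq_add, ← sub_eq_add_neg]
  ring

/-- The partial fraction decomposition of `1 / (℘ u - ℘ v)`. -/
theorem zetaBracket_mul {u v : ℂ} (hv : v ∉ L.lattice) (hv' : L.derivWeierstrassP v ≠ 0)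
    (hu : u ∉ L.lattice) (hm : u - v ∉ L.lattice) (hp : u + v ∉ L.lattice) :
    zetaBracket L v u * (L.weierstrassP u - L.weierstrassP v) = L.derivWeierstrassP v := by
  set f : ℂ → ℂ := fun u => zetaBracket L v u * (L.weierstrassP u - L.weierstrassP v) with hf
  have hcont : ∀ w, w ∉ L.lattice → w - v ∉ L.lattice → w + v ∉ L.lattice →
      Tendsto f (𝓝[≠] w) (𝓝 (f w)) := by
    intro w hw hwm hwp
    exact ((hasDerivAt_zetaBracket L hwm hwp).continuousAt.mul
      ((L.hasDerivAt_weierstrassP hw).continuousAt.sub continuousAt_const)).tendsto.mono_left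
      nhdsWithin_le_nhds
  have hmer : Meromorphic f := by
    have h1 := L.meromorphic_weierstrassP
    have h2 : Meromorphic fun u => weierstrassZeta L (u - v) := fun z =>
      MeromorphicAt.comp_analyticAt (g := (· - v)) (meromorphic_zeta L (z - v)) (by fun_prop)
    have h3 : Meromorphic fun u => weierstrassZeta L (u + v) := fun z =>
      MeromorphicAt.comp_analyticAt (g := (· + v)) (meromorphic_zeta L (z + v)) (by fun_prop)
    simp only [hf, zetaBracket]
    fun_prop
  -- Both zeta terms gain the same quasi-period, so the bracket is periodic and the product is
  -- elliptic without poles. Poles at translates of `-v` reduce to those of `v`, as the bracket is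
  -- odd in `v`.
  obtain ⟨c, hc⟩ := L.eventuallyEq_const_of_periodic hmer (fun l hl z => by
      filter_upwards [L.eventually_add_notMem_lattice z v, L.eventually_add_notMem_lattice z (-v)]
        with w h1 h2
      have h3 := zeta_add_sub_zeta L hl h1 h2
      simp only [hf, zetaBracket, L.weierstrassP_add_coe w ⟨l, hl⟩]
      rw [show w + l - v = w + -v + l by ring, show w + l + v = w + v + l by ring, sub_eq_add_neg w]
      linear_combination -h3 * (L.weierstrassP w - L.weierstrassP v)) (by
    intro z
    by_cases hz : z ∈ L.lattice
    · exact tendsto_zetaBracket_mul_at_lattice L hv hz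
    by_cases hzm : z - v ∈ L.lattice
    · have := tendsto_zetaBracket_mul_at_pole L hv hv' hzm
      rw [add_sub_cancel] at this
      exact ⟨_, this⟩
    by_cases hzp : z + v ∈ L.lattice
    · have := tendsto_zetaBracket_mul_at_pole L (v := -v) (by simpa using hv)
        (by rwa [L.derivWeierstrassP_neg, neg_ne_zero]) hzp
      rw [show -v + (z + v) = z by ring] at this
      refine ⟨_, this.neg.congr fun w => ?_⟩
      simp only [hf, zetaBracket_neg, L.weierstrassP_neg, neg_mul, neg_neg]
    · exact ⟨_, hcont z hz hzm hzp⟩)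
  have h1 : c = f u := tendsto_nhds_unique
    (tendsto_const_nhds.congr' (hc u).symm) (hcont u hu hm hp)
  have h2 := tendsto_zetaBracket_mul_at_pole L hv hv' (zero_mem L.lattice)
  have h3 : c = L.derivWeierstrassP v := tendsto_nhds_unique
    (tendsto_const_nhds.congr' (hc (v + 0)).symm) h2
  exact h1.symm.trans h3

/-- The derivative of `zetaBracket_mul` with respect to the second point. -/
theorem zetaBracket_deriv_mul {u v : ℂ} (hv : v ∉ L.lattice) (hv' : L.derivWeierstrassP v ≠ 0)
    (hu : u ∉ L.lattice) (hm : u - v ∉ L.lattice) (hp : u + v ∉ L.lattice) :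
    (L.weierstrassP (u - v) + L.weierstrassP (u + v) - 2 * L.weierstrassP v) *
      (L.weierstrassP u - L.weierstrassP v) - zetaBracket L v u * L.derivWeierstrassP v =
      deriv L.derivWeierstrassP v := by
  have h1 := (hasDerivAt_zetaBracket_left L hv hm hp).mul
    ((L.hasDerivAt_weierstrassP hv).const_sub (L.weierstrassP u))
  have h2 := L.hasDerivAt_derivWeierstrassP hv
  have h3 : (fun v => zetaBracket L v u * (L.weierstrassP u - L.weierstrassP v)) =ᶠ[𝓝 v]
      L.derivWeierstrassP := by
    have hopen := L.isOpen_compl_lattice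
    filter_upwards [hopen.mem_nhds hv, h2.continuousAt.eventually_ne hv',
      (continuous_const.sub continuous_id).continuousAt.eventually (hopen.mem_nhds hm),
      (continuous_const.add continuous_id).continuousAt.eventually (hopen.mem_nhds hp)]
      with w h1 h2 h3 h4
    exact zetaBracket_mul L h1 h2 hu h3 h4
  have h4 := h1.unique (h2.congr_of_eventuallyEq h3)
  linear_combination h4

/-! ### The Weierstrass sigma function and its logarithmic derivative. -/

/-- The exponent cancels the Taylor terms of `log(1 - w)` up to degree two, leaving a cubic
remainder. -/
theorem norm_one_sub_mul_exp_sub_one_le {w : ℂ} (hw : ‖w‖ ≤ 1 / 2) :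
    ‖(1 - w) * Complex.exp (w + w ^ 2 / 2) - 1‖ ≤ 2 * ‖w‖ ^ 3 := by
  have hw1 : ‖w‖ < 1 := by linarith
  have hne : (1 : ℂ) - w ≠ 0 := by
    intro h
    rw [← sub_eq_zero.1 h, norm_one] at hw1
    exact lt_irrefl _ hw1
  have h := Complex.norm_log_sub_logTaylor_le 2 (z := -w) (by simpa using hw1)
  have ht : Complex.logTaylor (2 + 1) (-w) = -w - w ^ 2 / 2 := by
    simp [Complex.logTaylor_succ, Complex.logTaylor_zero]
    ring
  rw [ht, norm_neg] at h
  set x := Complex.log (1 + -w) - (-w - w ^ 2 / 2) with hx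
  have he : (1 - w) * Complex.exp (w + w ^ 2 / 2) = Complex.exp x := by
    rw [hx, show Complex.log (1 + -w) - (-w - w ^ 2 / 2) = Complex.log (1 - w) + (w + w ^ 2 / 2) by
      rw [← sub_eq_add_neg]; ring, Complex.exp_add (Complex.log (1 - w)), Complex.exp_log hne]
  have hinv : (1 - ‖w‖)⁻¹ ≤ 2 := by
    rw [inv_le_comm₀ (by linarith) (by norm_num)]
    linarith
  have hxb : ‖x‖ ≤ ‖w‖ ^ 3 := by
    refine h.trans ?_
    have : 0 ≤ ‖w‖ ^ 3 := by positivity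
    push_cast
    norm_num
    nlinarith
  have hx1 : ‖x‖ ≤ 1 := hxb.trans (pow_le_one₀ (norm_nonneg _) hw1.le)
  rw [he]
  calc ‖Complex.exp x - 1‖ ≤ 2 * ‖x‖ := Complex.norm_exp_sub_one_le hx1
    _ ≤ _ := by linarith

/-- The factor of the sigma function that belongs to the point `l`. -/
noncomputable def sigmaFactor (l z : ℂ) : ℂ :=
  (1 - z / l) * Complex.exp (z / l + z ^ 2 / (2 * l ^ 2))

theorem norm_sigmaFactor_sub_one_le {r : ℝ} {z l : ℂ} (hr : 0 < r) (hz : ‖z‖ < r)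
    (h : 2 * r ≤ ‖l‖) : ‖sigmaFactor l z - 1‖ ≤ 2 * r ^ 3 * ‖l‖ ^ (-3 : ℝ) := by
  have hl : 0 < ‖l‖ := by linarith
  have hw : ‖z / l‖ ≤ 1 / 2 := by
    rw [norm_div, div_le_iff₀ hl]
    linarith
  have e2 : ‖l‖ ^ (-3 : ℝ) = (‖l‖ ^ 3)⁻¹ := by norm_cast
  have h1 := norm_one_sub_mul_exp_sub_one_le hw
  rw [show z / l + (z / l) ^ 2 / 2 = z / l + z ^ 2 / (2 * l ^ 2) by rw [div_pow]; ring] at h1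
  refine h1.trans ?_
  rw [norm_div, div_pow, e2, mul_assoc, ← div_eq_mul_inv]
  gcongr

theorem eventually_cofinite_norm_le (r : ℝ) : ∀ᶠ l : L.lattice in cofinite, r ≤ ‖(l : ℂ)‖ := by
  have h : Tendsto (fun l : L.lattice => ‖l‖) cofinite atTop := by
    rw [← Filter.cocompact_eq_cofinite]
    exact tendsto_norm_cocompact_atTop
  exact h.eventually_ge_atTop r

theorem summable_rpow_neg_three (C : ℝ) :
    Summable fun l : L.lattice => C * ‖l‖ ^ (-3 : ℝ) :=
  (ZLattice.summable_norm_rpow _ _ (by simp; norm_num)).mul_left _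

theorem differentiable_sigmaFactor (l : ℂ) : Differentiable ℂ (sigmaFactor l) := by
  unfold sigmaFactor
  fun_prop

theorem multipliableLocallyUniformlyOn_sigmaFactor {r : ℝ} (hr : 0 < r) :
    MultipliableLocallyUniformlyOn (fun (l : L.lattice) z => sigmaFactor l z) (Metric.ball 0 r) := by
  have h := Summable.multipliableLocallyUniformlyOn_one_add
    (f := fun (l : L.lattice) z => sigmaFactor l z - 1) (K := Metric.ball 0 r) Metric.isOpen_ball (summable_rpow_neg_three L (2 * r ^ 3)) (by
      filter_upwards [eventually_cofinite_norm_le L (2 * r)] with l hl z hz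
      exact norm_sigmaFactor_sub_one_le hr (by simpa using hz) hl)
    (fun l => ((differentiable_sigmaFactor l).continuous.sub continuous_const).continuousOn)
  simpa using h

theorem sigmaFactor_ne_zero {l z : ℂ} (h : l = 0 ∨ z ≠ l) : sigmaFactor l z ≠ 0 := by
  refine mul_ne_zero ?_ (Complex.exp_ne_zero _)
  rcases eq_or_ne l 0 with rfl | hl
  · simp
  · have hz := h.resolve_left hl
    rw [sub_ne_zero, ne_eq, eq_div_iff hl, one_mul]
    exact hz.symm

theorem tprod_sigmaFactor_ne_zero {z : ℂ} (hz : z ∉ L.lattice) :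
    ∏' l : L.lattice, sigmaFactor l z ≠ 0 := by
  have hr : 0 < ‖z‖ + 1 := by positivity
  have h := tprod_one_add_ne_zero_of_summable (f := fun l : L.lattice => sigmaFactor l z - 1)
    (fun l => by
      rw [add_sub_cancel]
      exact sigmaFactor_ne_zero (Or.inr fun e => hz (e ▸ l.2)))
    ((summable_rpow_neg_three L (2 * (‖z‖ + 1) ^ 3)).of_norm_bounded_eventually (by
      filter_upwards [eventually_cofinite_norm_le L (2 * (‖z‖ + 1))] with l hl
      rw [norm_norm]
      exact norm_sigmaFactor_sub_one_le hr (by linarith) hl))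
  simpa using h

/-- The factor of `l = 0` is constantly `1`; with this convention the right-hand sides are the terms
of `zetaExcept L 0`. -/
theorem logDeriv_sigmaFactor {l z : ℂ} (h : z ≠ l) :
    logDeriv (sigmaFactor l) z = if l = 0 then 0 else 1 / (z - l) + 1 / l + z / l ^ 2 := by
  split_ifs with hl
  · subst hl
    have : sigmaFactor 0 = fun _ => 1 := by ext w; simp [sigmaFactor]
    rw [this]
    simp [logDeriv]
  · have hzl : z - l ≠ 0 := sub_ne_zero.2 h
    have hlz : l - z ≠ 0 := sub_ne_zero.2 h.symm
    have h1 : HasDerivAt (fun z : ℂ => 1 - z / l) (-(1 / l)) z :=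
      ((hasDerivAt_id z).div_const l).const_sub 1
    have h2 : HasDerivAt (fun z : ℂ => z / l + z ^ 2 / (2 * l ^ 2)) (1 / l + z / l ^ 2) z := by
      refine (((hasDerivAt_id z).div_const l).add
        (((hasDerivAt_id z).pow 2).div_const (2 * l ^ 2))).congr_deriv ?_
      simp only [id]
      push_cast
      field_simp
    have h3 := h1.mul h2.cexp
    have h4 : deriv (sigmaFactor l) z = _ := h3.deriv
    rw [logDeriv_apply, h4]
    have he := Complex.exp_ne_zero (z / l + z ^ 2 / (2 * l ^ 2))
    rw [sigmaFactor]
    have h5 : (1 : ℂ) - z / l ≠ 0 := by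
      rw [one_sub_div hl]
      exact div_ne_zero hlz hl
    have h6 : 1 / (z - l) = -(1 / l) / (1 - z / l) := by
      rw [eq_div_iff h5]
      field_simp
      ring
    rw [h6]
    field_simp
    ring

theorem weierstrassSigma_ne_zero {z : ℂ} (hz : z ∉ L.lattice) : weierstrassSigma L z ≠ 0 :=
  mul_ne_zero (fun h => hz (h ▸ zero_mem _)) (tprod_sigmaFactor_ne_zero L hz)

/-- The zeta function is the logarithmic derivative of the sigma function. -/
theorem hasDerivAt_sigma {z : ℂ} (hz : z ∉ L.lattice) :
    HasDerivAt (weierstrassSigma L) (weierstrassSigma L z * weierstrassZeta L z) z := by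
  have hz0 : z ≠ 0 := fun h => hz (h ▸ zero_mem _)
  have hr : 0 < ‖z‖ + 1 := by positivity
  have hball : z ∈ Metric.ball (0 : ℂ) (‖z‖ + 1) := by simp
  have hmul := multipliableLocallyUniformlyOn_sigmaFactor L hr
  have hzl : ∀ l : L.lattice, z ≠ l := fun l e => hz (e ▸ l.2)
  have hsum : HasSum (fun l : L.lattice => logDeriv (sigmaFactor l) z) (zetaExcept L 0 z) := by
    have h1 := ((hasSumLocallyUniformly_zetaExcept L 0).tendstoLocallyUniformlyOn.tendsto_at
      (Set.mem_univ z))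
    simp_rw [fun l : L.lattice => logDeriv_sigmaFactor (hzl l)]
    exact h1
  have hne := tprod_sigmaFactor_ne_zero L hz
  have hlog := logDeriv_tprod_eq_tsum (f := fun (l : L.lattice) z => sigmaFactor l z)
    Metric.isOpen_ball hball
    (fun l => sigmaFactor_ne_zero (Or.inr (hzl l)))
    (fun l => (differentiable_sigmaFactor l).differentiableOn) hsum.summable hmul hne
  rw [hsum.tsum_eq, logDeriv_apply, div_eq_iff hne] at hlog
  have hdiff : DifferentiableAt ℂ (fun z => ∏' l : L.lattice, sigmaFactor l z) z := by
    have := hmul.hasProdLocallyUniformlyOn.differentiableOn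
      (Eventually.of_forall fun s => by
        have := fun l : L.lattice => differentiable_sigmaFactor (l : ℂ)
        fun_prop) Metric.isOpen_ball
    exact this.differentiableAt (Metric.isOpen_ball.mem_nhds hball)
  have h := (hasDerivAt_id z).mul hdiff.hasDerivAt
  rw [hlog] at h
  refine h.congr_deriv ?_
  -- The missing term `1/z` of zeta comes from the leading factor `z` of sigma.
  rw [← zetaExcept_add L (zero_mem L.lattice) z]
  change _ = z * (∏' l : L.lattice, sigmaFactor l z) * _
  simp only [id, sub_zero, div_zero, ne_eq, OfNat.ofNat_ne_zero, not_false_eq_true, zero_pow]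
  field_simp
  ring

end MilnePinney

/-! ### Lattices with `g₃ = 0` and prescribed `g₂`. -/

namespace PeriodPair

/-- The invariants of a period lattice do not vanish simultaneously. -/
theorem g₂_ne_zero_of_g₃_eq_zero (L : PeriodPair) (h3 : L.g₃ = 0) : L.g₂ ≠ 0 := by
  intro h2
  -- With both invariants zero, `℘'² = 4℘³`. At a zero of `℘` of order `n` this would force `2(n -
  -- 1) = 3n`; infinite order is excluded because `℘` is not constant.
  obtain ⟨u, hu, hu0⟩ := L.exists_weierstrassP_eq 0
  have hana := L.analyticOnNhd_weierstrassP u hu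
  have hana' := L.analyticOnNhd_derivWeierstrassP u hu
  have heq : L.derivWeierstrassP ^ 2 =ᶠ[𝓝 u] (fun _ => (4 : ℂ)) * L.weierstrassP ^ 3 := by
    filter_upwards [L.isOpen_compl_lattice.mem_nhds hu] with z hz
    simp only [Pi.pow_apply, Pi.mul_apply]
    rw [L.derivWeierstrassP_sq z hz, h2, h3]
    ring
  have hord := analyticOrderAt_congr heq
  have h4 : analyticOrderAt (fun _ : ℂ => (4 : ℂ)) u = 0 :=
    analyticOrderAt_eq_zero.2 (Or.inr (by norm_num))
  rw [analyticOrderAt_pow hana', analyticOrderAt_mul analyticAt_const (hana.pow 3),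
    analyticOrderAt_pow hana, h4, zero_add] at hord
  have hd : analyticOrderAt L.derivWeierstrassP u + 1 = analyticOrderAt L.weierstrassP u := by
    have := hana.analyticOrderAt_deriv_add_one
    simpa only [L.deriv_weierstrassP, hu0, sub_zero] using this
  rcases eq_or_ne (analyticOrderAt L.weierstrassP u) ⊤ with h | h
  · rw [analyticOrderAt_eq_top] at h
    have hall := L.analyticOnNhd_weierstrassP.eqOn_zero_of_preconnected_of_eventuallyEq_zero
      L.isPreconnected_compl_lattice hu h
    obtain ⟨b, hb, hb'⟩ := L.exists_weierstrassP_eq 1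
    have := hall hb
    simp [hb'] at this
  · obtain ⟨n, hn⟩ := ENat.ne_top_iff_exists.1 h
    have h' : analyticOrderAt L.derivWeierstrassP u ≠ ⊤ := by
      intro e
      rw [e] at hd
      exact h (by rw [← hd]; rfl)
    obtain ⟨m, hm⟩ := ENat.ne_top_iff_exists.1 h'
    rw [← hn, ← hm] at hord hd
    have e1 : m + 1 = n := by exact_mod_cast hd
    have e2 : 2 * m = 3 * n := by
      simp only [nsmul_eq_mul] at hord
      exact_mod_cast hord
    omega

/-- The square lattice with first period `a`. -/
noncomputable def gaussianPair (a : ℂ) (ha : a ≠ 0) : PeriodPair where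
  ω₁ := a
  ω₂ := a * Complex.I
  indep := by
    rw [LinearIndependent.pair_iff]
    intro s t h
    have h1 : a * (s + t * Complex.I) = 0 := by
      rw [← h]
      simp only [Complex.real_smul]
      ring
    have h2 := (mul_eq_zero.1 h1).resolve_left ha
    exact ⟨by simpa using congrArg Complex.re h2, by simpa using congrArg Complex.im h2⟩

theorem mem_gaussianPair {a : ℂ} (ha : a ≠ 0) {x : ℂ} :
    x ∈ (gaussianPair a ha).lattice ↔ ∃ m n : ℤ, x = a * (m + n * Complex.I) := by
  rw [mem_lattice]
  refine exists_congr fun m => exists_congr fun n => ?_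
  change (m : ℂ) * a + n * (a * Complex.I) = x ↔ _
  constructor
  · rintro rfl; ring
  · rintro rfl; ring

/-- Eisenstein sums of a lattice and of its multiple by `k`. -/
theorem G_mul_of_forall_mem_iff {L M : PeriodPair} {k : ℂ} (hk : k ≠ 0)
    (h : ∀ x, x ∈ L.lattice ↔ k * x ∈ M.lattice) (n : ℕ) : M.G n = (k ^ n)⁻¹ * L.G n := by
  let e : L.lattice ≃ M.lattice :=
    { toFun := fun x => ⟨k * x, (h x).1 x.2⟩
      invFun := fun y => ⟨k⁻¹ * y, (h _).2 (by rw [mul_inv_cancel_left₀ hk]; exact y.2)⟩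
      left_inv := fun x => Subtype.ext (inv_mul_cancel_left₀ hk _)
      right_inv := fun y => Subtype.ext (mul_inv_cancel_left₀ hk _) }
  unfold G
  rw [← tsum_mul_left, ← e.tsum_eq]
  refine tsum_congr fun l => ?_
  change ((k * (l : ℂ)) ^ n)⁻¹ = _
  rw [mul_pow, mul_inv]

theorem gaussianPair_g₃ (a : ℂ) (ha : a ≠ 0) : (gaussianPair a ha).g₃ = 0 := by
  -- Multiplication by `i` preserves the square lattice but multiplies its sixth Eisenstein sum by
  -- `i⁻⁶ = -1`.
  have h := G_mul_of_forall_mem_iff (L := gaussianPair a ha) (M := gaussianPair a ha)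
    Complex.I_ne_zero (fun x => by
      rw [mem_gaussianPair, mem_gaussianPair]
      constructor
      · rintro ⟨m, n, rfl⟩
        refine ⟨-n, m, ?_⟩
        push_cast
        linear_combination a * n * Complex.I_mul_I
      · rintro ⟨m, n, h⟩
        refine ⟨n, -m, ?_⟩
        push_cast
        linear_combination -Complex.I * h + (x - a * n) * Complex.I_mul_I) 6
  have h6 : (Complex.I ^ 6)⁻¹ = -1 := by
    rw [show Complex.I ^ 6 = (Complex.I ^ 2) ^ 3 by ring, Complex.I_sq]
    norm_num
  rw [h6] at h
  rw [g₃]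
  linear_combination 70 * h

/-- There is a lattice with invariants `g` and `0` for each `g ≠ 0`. -/
theorem exists_invariants {g : ℂ} (hg : g ≠ 0) : ∃ L : PeriodPair, L.g₂ = g ∧ L.g₃ = 0 := by
  have h1 := (gaussianPair 1 one_ne_zero).g₂_ne_zero_of_g₃_eq_zero (gaussianPair_g₃ 1 one_ne_zero)
  -- Scaling the lattice by `a` multiplies `g₂` by `a⁻⁴`.
  obtain ⟨a, ha⟩ := IsAlgClosed.exists_pow_nat_eq ((gaussianPair 1 one_ne_zero).g₂ / g)
    (n := 4) (by norm_num)
  have ha4 : a ^ 4 ≠ 0 := by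
    rw [ha]
    exact div_ne_zero h1 hg
  have ha0 : a ≠ 0 := fun h => ha4 (by rw [h]; norm_num)
  refine ⟨gaussianPair a ha0, ?_, gaussianPair_g₃ a ha0⟩
  have h := G_mul_of_forall_mem_iff (L := gaussianPair 1 one_ne_zero) (M := gaussianPair a ha0)
    ha0 (fun x => by
      rw [mem_gaussianPair, mem_gaussianPair]
      refine exists_congr fun m => exists_congr fun n => ?_
      rw [one_mul, mul_right_inj' ha0]) 4
  have hg2 : (gaussianPair a ha0).g₂ = (a ^ 4)⁻¹ * (gaussianPair 1 one_ne_zero).g₂ := by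
    rw [g₂, g₂, h]
    ring
  rw [hg2, ha, inv_div, div_mul_cancel₀ _ h1]

end PeriodPair

/-! ### The Chiellini condition and the first-order equation. -/

namespace MilnePinney

section Calculus

variable {𝕜 : Type*} [RCLike 𝕜]

theorem hasDerivAt_of_sq_eq {c δ : 𝕜} {r : 𝕜 → 𝕜} {Y : 𝕜} (hr : DifferentiableAt 𝕜 r Y)
    (hsq : ∀ᶠ x in 𝓝 Y, r x ^ 2 = c * x ^ 4 - δ) (h0 : r Y ≠ 0) :
    HasDerivAt r (2 * c * Y ^ 3 / r Y) Y := by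
  have h1 : HasDerivAt (fun x => r x ^ 2) _ Y := hr.hasDerivAt.pow 2
  have h2 : HasDerivAt (fun x => c * x ^ 4 - δ) _ Y :=
    (((hasDerivAt_id Y).pow 4).const_mul c).sub_const δ
  have h3 := h1.unique (h2.congr_of_eventuallyEq hsq)
  refine hr.hasDerivAt.congr_deriv ?_
  rw [eq_div_iff h0]
  simp only [id] at h3
  push_cast at h3
  linear_combination h3 / 2

/-- Differentiating `ẏ = r(y)/y²` gives `ÿ = 2δ/y⁵`, while the damping and restoring terms
contribute `-δ/y⁵` each. -/
theorem solvesDampedAt_of_hasDerivAt {c δ : 𝕜} {r y : 𝕜 → 𝕜} {t : 𝕜}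
    (hy : ∀ᶠ s in 𝓝 t, HasDerivAt y (r (y s) / y s ^ 2) s) (h0 : y t ≠ 0)
    (hr : DifferentiableAt 𝕜 r (y t)) (hsq : ∀ᶠ x in 𝓝 (y t), r x ^ 2 = c * x ^ 4 - δ)
    (hr0 : r (y t) ≠ 0) : SolvesDampedAt δ (damping δ r) y t := by
  have hyt := hy.self_of_nhds
  have h1 := ((hasDerivAt_of_sq_eq hr hsq hr0).comp t hyt).div (hyt.pow 2) (pow_ne_zero 2 h0)
  have h2 := h1.congr_of_eventuallyEq (f₁ := deriv y) (hy.mono fun s hs => hs.deriv)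
  refine ⟨hyt.differentiableAt, h2.differentiableAt, ?_⟩
  rw [h2.deriv, hyt.deriv, damping, restoring]
  have h3 := hsq.self_of_nhds
  simp only [Function.comp_apply, Pi.pow_apply]
  push_cast
  field_simp
  linear_combination -2 * h3

/-- The quotient `h/g` is simply `r/Y²`, with derivative `2δ/(Y³r)`. -/
theorem chiellini_of_sq_eq {c δ : 𝕜} {r : 𝕜 → 𝕜} {Y : 𝕜} (hδ : δ ≠ 0) (hY : Y ≠ 0)
    (hr : DifferentiableAt 𝕜 r Y) (hsq : ∀ᶠ x in 𝓝 Y, r x ^ 2 = c * x ^ 4 - δ) (h0 : r Y ≠ 0) :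
    damping δ r Y ≠ 0 ∧
      HasDerivAt (fun x => restoring δ x / damping δ r x) (-2 * damping δ r Y) Y := by
  refine ⟨div_ne_zero (neg_ne_zero.2 hδ) (mul_ne_zero (pow_ne_zero 3 hY) h0), ?_⟩
  have h1 := (hasDerivAt_of_sq_eq hr hsq h0).div ((hasDerivAt_id Y).pow 2) (pow_ne_zero 2 hY)
  have h2 := h1.congr_of_eventuallyEq (f₁ := fun x => restoring δ x / damping δ r x) (by
    filter_upwards [eventually_ne_nhds hY, hr.continuousAt.eventually_ne h0] with x hx hrx
    simp only [restoring, damping, Pi.div_apply, Pi.pow_apply, id]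
    field_simp)
  refine h2.congr_deriv ?_
  have h3 := hsq.self_of_nhds
  simp only [damping, id, Pi.pow_apply]
  push_cast
  field_simp
  linear_combination -h3

end Calculus

section RealRoot

theorem sqrt_sub_mul_inv (c δ : ℝ) {Y : ℝ} (hY : Y ≠ 0) :
    √(c - δ * (Y ^ 4)⁻¹) = √(c * Y ^ 4 - δ) / Y ^ 2 := by
  have h : c - δ * (Y ^ 4)⁻¹ = (c * Y ^ 4 - δ) / (Y ^ 2) ^ 2 := by
    field_simp
  rw [h, Real.sqrt_div' _ (by positivity), Real.sqrt_sq (by positivity)]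

theorem sign_mul_sqrt_sq {c δ ε Y : ℝ} (hε : ε = 1 ∨ ε = -1) (h : 0 < c * Y ^ 4 - δ) :
    (ε * √(c * Y ^ 4 - δ)) ^ 2 = c * Y ^ 4 - δ := by
  rw [mul_pow, Real.sq_sqrt h.le]
  rcases hε with rfl | rfl <;> ring

theorem eventually_quartic_pos {c δ Y : ℝ} (h : 0 < c * Y ^ 4 - δ) :
    ∀ᶠ x in 𝓝 Y, 0 < c * x ^ 4 - δ := by
  have : ContinuousAt (fun x : ℝ => c * x ^ 4 - δ) Y := by fun_prop
  exact this.eventually (lt_mem_nhds h)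

theorem sign_mul_sqrt_ne_zero {c δ ε Y : ℝ} (hε : ε = 1 ∨ ε = -1) (h : 0 < c * Y ^ 4 - δ) :
    ε * √(c * Y ^ 4 - δ) ≠ 0 := by
  refine mul_ne_zero ?_ (Real.sqrt_pos.2 h).ne'
  rcases hε with rfl | rfl <;> norm_num

theorem differentiableAt_sign_mul_sqrt {c δ ε Y : ℝ} (h : 0 < c * Y ^ 4 - δ) :
    DifferentiableAt ℝ (fun x => ε * √(c * x ^ 4 - δ)) Y :=
  ((by fun_prop : DifferentiableAt ℝ (fun x : ℝ => c * x ^ 4 - δ) Y).sqrt h.ne').const_mul ε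

theorem solvesDampedAt_real {δ c ε : ℝ} (hε : ε = 1 ∨ ε = -1) {J : Set ℝ} {y : ℝ → ℝ}
    (hJ : IsOpen J) (hy : ∀ t ∈ J, y t ≠ 0 ∧ 0 < c * y t ^ 4 - δ ∧
      HasDerivAt y (ε * √(c - δ * (y t ^ 4)⁻¹)) t) {t : ℝ} (ht : t ∈ J) :
    SolvesDampedAt δ (damping δ (fun x => ε * √(c * x ^ 4 - δ))) y t := by
  obtain ⟨h0, hpos, -⟩ := hy t ht
  refine solvesDampedAt_of_hasDerivAt (c := c) ?_ h0 (differentiableAt_sign_mul_sqrt hpos)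
    ((eventually_quartic_pos hpos).mono fun x hx => sign_mul_sqrt_sq hε hx)
    (sign_mul_sqrt_ne_zero hε hpos)
  filter_upwards [hJ.mem_nhds ht] with s hs
  obtain ⟨h0, -, hd⟩ := hy s hs
  rwa [sqrt_sub_mul_inv c δ h0, ← mul_div_assoc] at hd

theorem chielliniOn_real {δ c ε : ℝ} (hδ : δ ≠ 0) (hε : ε = 1 ∨ ε = -1) :
    ChielliniOn (-2) (damping δ (fun x => ε * √(c * x ^ 4 - δ))) (restoring δ)
      {Y | Y ≠ 0 ∧ 0 < c * Y ^ 4 - δ} := fun _ hY =>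
  chiellini_of_sq_eq (c := c) hδ hY.1 (differentiableAt_sign_mul_sqrt hY.2)
    ((eventually_quartic_pos hY.2).mono fun _ hx => sign_mul_sqrt_sq hε hx)
    (sign_mul_sqrt_ne_zero hε hY.2)

/-- The Chiellini condition determines the damping up to a constant and a sign. -/
theorem exists_of_chielliniOn {δ : ℝ} {J : Set ℝ} {g : ℝ → ℝ} (hδ : δ ≠ 0) (hJ : IsOpen J)
    (hJ' : IsPreconnected J) (h0 : (0 : ℝ) ∉ J) (hg : ChielliniOn (-2) g (restoring δ) J) :
    ∃ c ε : ℝ, (ε = 1 ∨ ε = -1) ∧ ∀ Y ∈ J, 0 < c * Y ^ 4 - δ ∧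
      restoring δ Y / g Y = ε * √(c - δ * (Y ^ 4)⁻¹) ∧
      g Y = damping δ (fun x => ε * √(c * x ^ 4 - δ)) Y := by
  rcases J.eq_empty_or_nonempty with rfl | ⟨Y₀, hY₀⟩
  · exact ⟨0, 1, Or.inl rfl, fun _ h => h.elim⟩
  have hne : ∀ Y ∈ J, Y ≠ 0 := fun Y hY e => h0 (e ▸ hY)
  set u : ℝ → ℝ := fun Y => restoring δ Y / g Y with hu
  have hu0 : ∀ Y ∈ J, u Y ≠ 0 := fun Y hY =>
    div_ne_zero (div_ne_zero (neg_ne_zero.2 hδ) (pow_ne_zero 5 (hne Y hY))) (hg Y hY).1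
  -- The first integral: `(u²)' = 2u · (-2g) = -4h = 4δ/Y⁵`. Its value is the constant `c`.
  have hd : ∀ Y ∈ J, HasDerivAt (fun Y => u Y ^ 2 + δ * (Y ^ 4)⁻¹) 0 Y := by
    intro Y hY
    have hY0 := hne Y hY
    have hgY := (hg Y hY).1
    refine (((hg Y hY).2.pow 2).add
      ((((hasDerivAt_id Y).pow 4).inv (pow_ne_zero 4 hY0)).const_mul δ)).congr_deriv ?_
    simp only [restoring, id, Pi.pow_apply]
    push_cast
    field_simp
    ring
  have hconst := fun Y (hY : Y ∈ J) => hJ.is_const_of_deriv_eq_zero hJ'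
    (fun x hx => (hd x hx).differentiableAt.differentiableWithinAt)
    (fun x hx => (hd x hx).deriv) hY hY₀
  set c := u Y₀ ^ 2 + δ * (Y₀ ^ 4)⁻¹ with hc
  have hsq : ∀ Y ∈ J, u Y ^ 2 = c - δ * (Y ^ 4)⁻¹ := fun Y hY => by
    linear_combination hconst Y hY
  have hpos' : ∀ Y ∈ J, 0 < c - δ * (Y ^ 4)⁻¹ := fun Y hY => by
    rw [← hsq Y hY]
    have := hu0 Y hY
    positivity
  have hpos : ∀ Y ∈ J, 0 < c * Y ^ 4 - δ := fun Y hY => by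
    have hY4 : 0 < Y ^ 4 := by have := hne Y hY; positivity
    have h := mul_pos (hpos' Y hY) hY4
    rwa [sub_mul, mul_assoc, inv_mul_cancel₀ hY4.ne', mul_one] at h
  have hcont : ContinuousOn u J := fun Y hY => (hg Y hY).2.continuousAt.continuousWithinAt
  have hcont' : ContinuousOn (fun Y => √(c - δ * (Y ^ 4)⁻¹)) J := by
    intro Y hY
    have := pow_ne_zero 4 (hne Y hY)
    exact ContinuousAt.continuousWithinAt (by fun_prop (disch := assumption))
  -- Two continuous functions with equal nonvanishing squares on a connected set agree up to one
  -- global sign.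
  have hε : ∃ ε : ℝ, (ε = 1 ∨ ε = -1) ∧ ∀ Y ∈ J, u Y = ε * √(c - δ * (Y ^ 4)⁻¹) := by
    rcases hJ'.eq_or_eq_neg_of_sq_eq hcont hcont' (fun Y hY => by
      simp only [Pi.pow_apply]
      rw [Real.sq_sqrt (hpos' Y hY).le, hsq Y hY])
      (fun {Y} hY => (Real.sqrt_pos.2 (hpos' Y hY)).ne') with h | h
    · exact ⟨1, Or.inl rfl, fun Y hY => by rw [h hY, one_mul]⟩
    · exact ⟨-1, Or.inr rfl, fun Y hY => by rw [h hY, neg_one_mul]; rfl⟩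
  obtain ⟨ε, hε1, hε2⟩ := hε
  refine ⟨c, ε, hε1, fun Y hY => ⟨hpos Y hY, hε2 Y hY, ?_⟩⟩
  have hY0 := hne Y hY
  have h1 := hε2 Y hY
  rw [sqrt_sub_mul_inv c δ hY0, ← mul_div_assoc] at h1
  have h2 := sign_mul_sqrt_ne_zero hε1 (hpos Y hY)
  have h3 := (hg Y hY).1
  simp only [hu, restoring] at h1
  simp only [damping]
  rw [div_div, div_eq_div_iff (mul_ne_zero (pow_ne_zero 5 hY0) h3) (pow_ne_zero 2 hY0)] at h1
  rw [eq_div_iff (mul_ne_zero (pow_ne_zero 3 hY0) h2)]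
  have h4 : Y ^ 2 ≠ 0 := pow_ne_zero 2 hY0
  refine mul_right_cancel₀ h4 ?_
  linear_combination -h1

end RealRoot

/-! ### Derivatives of the parametric formulas with respect to `ω`. -/

theorem deriv_quartic (c δ : ℂ) : deriv (quartic c δ) = fun Y => 4 * c * Y ^ 3 := by
  ext Y
  have h : HasDerivAt (quartic c δ) _ Y := (((hasDerivAt_id Y).pow 4).const_mul c).sub_const δ
  rw [h.deriv]
  simp only [id]
  push_cast
  ring

theorem deriv_deriv_quartic (c δ Y : ℂ) : deriv (deriv (quartic c δ)) Y = 12 * c * Y ^ 2 := by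
  rw [deriv_quartic]
  have h := ((hasDerivAt_id Y).pow 3).const_mul (4 * c)
  have h' : HasDerivAt (fun Y => 4 * c * Y ^ 3) _ Y := h
  rw [h'.deriv]
  simp only [id]
  push_cast
  ring

section Param

variable {L : PeriodPair} {c δ y₀ ω₀ : ℂ}

theorem coeff_ne_zero (hδ : δ ≠ 0) (hy : quartic c δ y₀ = 0) : c ≠ 0 ∧ y₀ ≠ 0 := by
  rw [quartic, sub_eq_zero] at hy
  constructor
  · rintro rfl
    exact hδ (by rw [← hy, zero_mul])
  · rintro rfl
    exact hδ (by rw [← hy]; ring)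

theorem g₂_eq (hL : HasInvariants L c y₀) : L.g₂ = -(c ^ 2 * y₀ ^ 4) := by
  rw [hL.1, invariantTwo]; ring

theorem g₃_eq (hL : HasInvariants L c y₀) : L.g₃ = 0 := by
  rw [hL.2, invariantThree]; ring

theorem weierstrassP_base (h : IsBasePoint L c δ y₀ ω₀) : L.weierstrassP ω₀ = c * y₀ ^ 2 / 2 := by
  rw [h.2, deriv_deriv_quartic]; ring

theorem derivWeierstrassP_base_sq (hL : HasInvariants L c y₀) (h : IsBasePoint L c δ y₀ ω₀) :
    L.derivWeierstrassP ω₀ ^ 2 = c ^ 3 * y₀ ^ 6 := by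
  rw [L.derivWeierstrassP_sq ω₀ h.1, g₂_eq hL, g₃_eq hL, weierstrassP_base h]
  ring

theorem derivWeierstrassP_base_ne_zero (hδ : δ ≠ 0) (hy : quartic c δ y₀ = 0)
    (hL : HasInvariants L c y₀) (h : IsBasePoint L c δ y₀ ω₀) : L.derivWeierstrassP ω₀ ≠ 0 := by
  obtain ⟨hc, hy0⟩ := coeff_ne_zero hδ hy
  intro h0
  have := derivWeierstrassP_base_sq hL h
  rw [h0] at this
  have h1 : c ^ 3 * y₀ ^ 6 ≠ 0 := by positivity
  exact h1 (by rw [← this]; ring)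

/-- The shifted parameter avoids the singularities of the parametric formulas. -/
def IsRegular (L : PeriodPair) (ω₀ u : ℂ) : Prop :=
  u ∉ L.lattice ∧ u + ω₀ ∉ L.lattice ∧ u - ω₀ ∉ L.lattice

theorem paramY_eq (C ω : ℂ) : paramY L c δ y₀ C ω =
    y₀ + c * y₀ ^ 3 / (L.weierstrassP (ω + C) - c * y₀ ^ 2 / 2) := by
  rw [paramY, deriv_deriv_quartic, deriv_quartic]
  dsimp only
  rw [show 12 * c * y₀ ^ 2 / 24 = c * y₀ ^ 2 / 2 by ring, mul_assoc 4 c,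
    mul_div_mul_left _ _ (by norm_num : (4 : ℂ) ≠ 0)]

/-- The derivative of `paramY` with respect to the parameter. -/
noncomputable def paramVelocity (L : PeriodPair) (c y₀ u : ℂ) : ℂ :=
  -(c * y₀ ^ 3) * L.derivWeierstrassP u / (L.weierstrassP u - c * y₀ ^ 2 / 2) ^ 2

variable (hδ : δ ≠ 0) (hy : quartic c δ y₀ = 0) (hL : HasInvariants L c y₀)
  (hb : IsBasePoint L c δ y₀ ω₀)

section

include hδ hy hL hb

/-- By `zetaBracket_mul` this difference is a factor of `℘'(ω₀)`, which is nonzero. -/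
theorem weierstrassP_sub_ne_zero {u : ℂ} (hu : IsRegular L ω₀ u) :
    L.weierstrassP u - c * y₀ ^ 2 / 2 ≠ 0 := by
  intro h
  have h1 := derivWeierstrassP_base_ne_zero hδ hy hL hb
  have h2 := zetaBracket_mul L hb.1 h1 hu.1 hu.2.2 hu.2.1
  rw [weierstrassP_base hb, h, mul_zero] at h2
  exact h1 h2.symm

theorem hasDerivAt_paramY {C ω : ℂ} (hu : IsRegular L ω₀ (ω + C)) :
    HasDerivAt (paramY L c δ y₀ C) (paramVelocity L c y₀ (ω + C)) ω := by
  have hne := weierstrassP_sub_ne_zero hδ hy hL hb hu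
  have h1 := ((L.hasDerivAt_weierstrassP hu.1).comp_add_const ω C).sub_const (c * y₀ ^ 2 / 2)
  have h2 := ((h1.inv hne).const_mul (c * y₀ ^ 3)).const_add y₀
  rw [funext (paramY_eq (L := L) (c := c) (δ := δ) (y₀ := y₀) C)]
  refine (h2.congr_deriv ?_).congr_of_eventuallyEq (Eventually.of_forall fun x => ?_)
  · rw [paramVelocity]; ring
  · simp [div_eq_mul_inv]

theorem paramVelocity_sq {C ω : ℂ} (hu : IsRegular L ω₀ (ω + C)) :
    paramVelocity L c y₀ (ω + C) ^ 2 = c * paramY L c δ y₀ C ω ^ 4 - δ := by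
  have hne := weierstrassP_sub_ne_zero hδ hy hL hb hu
  have h2 := L.derivWeierstrassP_sq _ hu.1
  rw [g₂_eq hL, g₃_eq hL] at h2
  -- The root `y₀` eliminates `δ`; what remains is a polynomial identity in `q = ℘ - ℘(ω₀)`.
  have hd : δ = c * y₀ ^ 4 := by rw [quartic] at hy; linear_combination -hy
  rw [paramY_eq, paramVelocity, hd, div_pow, mul_pow, h2]
  set p := L.weierstrassP (ω + C)
  have e : p = (p - c * y₀ ^ 2 / 2) + c * y₀ ^ 2 / 2 := by ring
  set q := p - c * y₀ ^ 2 / 2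
  rw [e]
  field_simp
  ring

theorem continuousAt_paramVelocity {C ω : ℂ} (hu : IsRegular L ω₀ (ω + C)) :
    ContinuousAt (fun ω => paramVelocity L c y₀ (ω + C)) ω := by
  have hne := weierstrassP_sub_ne_zero hδ hy hL hb hu
  have h1 := ((L.hasDerivAt_weierstrassP hu.1).comp_add_const ω C).continuousAt
  have h2 := ((L.hasDerivAt_derivWeierstrassP hu.1).comp_add_const ω C).continuousAt
  exact (continuousAt_const.mul h2).div ((h1.sub continuousAt_const).pow 2) (pow_ne_zero 2 hne)

end

/-- The coefficient of the logarithm in `paramT`. -/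
noncomputable def logCoeff (L : PeriodPair) (c δ y₀ ω₀ : ℂ) : ℂ :=
  -(y₀ * deriv (quartic c δ) y₀) / (2 * L.derivWeierstrassP ω₀) +
    deriv (quartic c δ) y₀ ^ 2 * deriv L.derivWeierstrassP ω₀ / (16 * L.derivWeierstrassP ω₀ ^ 3)

/-- Isolates the only multivalued term, so that the rest is differentiated once for both complex and
real parameters. -/
theorem paramT_eq_add (C D ℓ ω : ℂ) : paramT L c δ y₀ ω₀ C D ℓ ω =
    logCoeff L c δ y₀ ω₀ * ℓ + paramT L c δ y₀ ω₀ C D 0 ω := by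
  simp only [paramT, logCoeff]
  ring

theorem paramT_add_const (C D E ℓ ω : ℂ) : paramT L c δ y₀ ω₀ C (D + E) ℓ ω =
    paramT L c δ y₀ ω₀ C D ℓ ω + E := by
  simp only [paramT]
  ring

-- The subtracted zeta terms are what the logarithm contributes later; together the derivative of
-- time is `Y²`.
include hδ hy hL hb in
theorem hasDerivAt_paramT_zero {C D ω : ℂ} (hu : IsRegular L ω₀ (ω + C)) :
    HasDerivAt (fun ω => paramT L c δ y₀ ω₀ C D 0 ω) (paramY L c δ y₀ C ω ^ 2 -
      logCoeff L c δ y₀ ω₀ *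
        (weierstrassZeta L (ω + C + ω₀) - weierstrassZeta L (ω + C - ω₀))) ω := by
  have hne := weierstrassP_sub_ne_zero hδ hy hL hb hu
  have hP' := derivWeierstrassP_base_ne_zero hδ hy hL hb
  have h1 := zetaBracket_mul L hb.1 hP' hu.1 hu.2.2 hu.2.1
  have h2 := zetaBracket_deriv_mul L hb.1 hP' hu.1 hu.2.2 hu.2.1
  have hzp : HasDerivAt (fun ω => weierstrassZeta L (ω + C + ω₀))
      (-L.weierstrassP (ω + C + ω₀)) ω := by
    have := (hasDerivAt_zeta L hu.2.1).comp_add_const (ω + C) ω₀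
    exact this.comp_add_const ω C
  have hzm : HasDerivAt (fun ω => weierstrassZeta L (ω + C - ω₀))
      (-L.weierstrassP (ω + C - ω₀)) ω := by
    have := (hasDerivAt_zeta L hu.2.2).comp_sub_const (ω + C) ω₀
    exact this.comp_add_const ω C
  simp only [paramT, mul_zero, add_zero]
  set f' := deriv (quartic c δ) y₀ with hf'
  set P := L.weierstrassP ω₀ with hP
  set P' := L.derivWeierstrassP ω₀ with hP'def
  set P'' := deriv L.derivWeierstrassP ω₀ with hP''
  set Z := weierstrassZeta L ω₀ with hZ
  have h3 := ((((hasDerivAt_id ω).const_mul (y₀ ^ 2)).sub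
    ((hzp.add hzm).const_mul (f' ^ 2 / (16 * P' ^ 2)))).add
    (((hasDerivAt_id ω).add_const C).mul_const (y₀ * f' / P' * Z
        - f' ^ 2 / 16 * (2 * P / P' ^ 2 + 2 * P'' * Z / P' ^ 3)))).add_const D
  refine h3.congr_deriv ?_
  have hYx : paramY L c δ y₀ C ω = y₀ + f' / 4 * (zetaBracket L ω₀ (ω + C) / P') := by
    have : zetaBracket L ω₀ (ω + C) / P' = 1 / (L.weierstrassP (ω + C) - P) := by
      rw [← weierstrassP_base hb, ← hP] at hne
      rw [div_eq_div_iff hP' hne]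
      linear_combination h1
    rw [this, paramY, ← hf', ← hb.2, ← hP, div_mul_div_comm, mul_one]
  -- Eliminating `℘(u) - P` between the two partial fraction identities expresses the squared
  -- bracket through terms that integrate to zeta and log sigma.
  have hsq : (L.weierstrassP (ω + C - ω₀) + L.weierstrassP (ω + C + ω₀) - 2 * P) * P' =
      zetaBracket L ω₀ (ω + C) * (P'' + zetaBracket L ω₀ (ω + C) * P') := by
    linear_combination zetaBracket L ω₀ (ω + C) * h2 -
      (L.weierstrassP (ω + C - ω₀) + L.weierstrassP (ω + C + ω₀) - 2 * P) * h1
  have hsq' : (zetaBracket L ω₀ (ω + C) / P') ^ 2 =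
      (L.weierstrassP (ω + C - ω₀) + L.weierstrassP (ω + C + ω₀) - 2 * P) / P' ^ 2 -
      P'' * zetaBracket L ω₀ (ω + C) / P' ^ 3 := by
    field_simp
    linear_combination -hsq
  rw [hYx, show (y₀ + f' / 4 * (zetaBracket L ω₀ (ω + C) / P')) ^ 2 =
    y₀ ^ 2 + y₀ * f' / 2 * (zetaBracket L ω₀ (ω + C) / P') +
    f' ^ 2 / 16 * (zetaBracket L ω₀ (ω + C) / P') ^ 2 by ring, hsq', logCoeff, zetaBracket,
    ← hf', ← hP'', ← hP'def, ← hZ]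
  field_simp
  ring

theorem hasDerivAt_sigma_quotient {C ω : ℂ} (hu : IsRegular L ω₀ (ω + C)) :
    HasDerivAt (fun ω => weierstrassSigma L (ω + C + ω₀) / weierstrassSigma L (ω + C - ω₀))
      (weierstrassSigma L (ω + C + ω₀) / weierstrassSigma L (ω + C - ω₀) *
        (weierstrassZeta L (ω + C + ω₀) - weierstrassZeta L (ω + C - ω₀))) ω := by
  have hsp : HasDerivAt (fun ω => weierstrassSigma L (ω + C + ω₀)) _ ω :=
    HasDerivAt.comp_add_const (f := fun x => weierstrassSigma L (x + ω₀)) ω C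
      ((hasDerivAt_sigma L hu.2.1).comp_add_const (ω + C) ω₀)
  have hsm : HasDerivAt (fun ω => weierstrassSigma L (ω + C - ω₀)) _ ω :=
    HasDerivAt.comp_add_const (f := fun x => weierstrassSigma L (x - ω₀)) ω C
      ((hasDerivAt_sigma L hu.2.2).comp_sub_const (ω + C) ω₀)
  have hne := weierstrassSigma_ne_zero L hu.2.2
  refine (hsp.div hsm hne).congr_deriv ?_
  field_simp

end Param

/-! ### Branches of logarithms and square roots, local inverses. -/

/-- A continuous logarithm agrees locally with a translate of the principal one. -/
theorem eventuallyEq_add_log {X : Type*} [TopologicalSpace X] {Λ F : X → ℂ} {x : X}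
    (hΛ : ContinuousAt Λ x) (hF : ∀ᶠ z in 𝓝 x, Complex.exp (Λ z) = F z) :
    Λ =ᶠ[𝓝 x] fun z => Λ x + Complex.log (F z / F x) := by
  -- Since `1 < π`, the principal logarithm recovers the increment `Λ z - Λ x` from its exponential.
  have h1 : ∀ᶠ z in 𝓝 x, ‖Λ z - Λ x‖ < 1 := by
    have : ContinuousAt (fun z => ‖Λ z - Λ x‖) x := (hΛ.sub continuousAt_const).norm
    exact this.eventually (gt_mem_nhds (by simp))
  filter_upwards [h1, hF] with z hz hFz
  have him := (Complex.abs_im_le_norm (Λ z - Λ x)).trans hz.le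
  rw [abs_le] at him
  rw [← hFz, ← hF.self_of_nhds, ← Complex.exp_sub, Complex.log_exp]
  · ring
  all_goals linarith [Real.pi_gt_three]

theorem hasDerivAt_log_branch {Λ F : ℂ → ℂ} {x D : ℂ} (hΛ : ContinuousAt Λ x)
    (hF : ∀ᶠ z in 𝓝 x, Complex.exp (Λ z) = F z) (hd : HasDerivAt F (F x * D) x) :
    HasDerivAt Λ D x := by
  have h0 : F x ≠ 0 := hF.self_of_nhds ▸ Complex.exp_ne_zero _
  have h1 := ((hd.div_const (F x)).clog (by rw [div_self h0]; exact Complex.one_mem_slitPlane)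
    ).const_add (Λ x)
  exact (h1.congr_of_eventuallyEq (eventuallyEq_add_log hΛ hF)).congr_deriv (by field_simp)

theorem hasDerivAt_log_branch_real {Λ F : ℝ → ℂ} {x : ℝ} {D : ℂ} (hΛ : ContinuousAt Λ x)
    (hF : ∀ᶠ z in 𝓝 x, Complex.exp (Λ z) = F z) (hd : HasDerivAt F (F x * D) x) :
    HasDerivAt Λ D x := by
  have h0 : F x ≠ 0 := hF.self_of_nhds ▸ Complex.exp_ne_zero _
  have h1 := ((hd.div_const (F x)).clog_real (by
    rw [div_self h0]; exact Complex.one_mem_slitPlane)).const_add (Λ x)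
  exact (h1.congr_of_eventuallyEq (eventuallyEq_add_log hΛ hF)).congr_deriv (by field_simp)

/-- A function with nonvanishing continuous derivative has a differentiable local inverse. -/
theorem exists_local_inverse {𝕜 : Type*} [RCLike 𝕜] {T T' : 𝕜 → 𝕜} {x : 𝕜} {S : Set 𝕜}
    (hS : IsOpen S) (hx : x ∈ S) (hT : ∀ ω ∈ S, HasDerivAt T (T' ω) ω) (hT' : ContinuousAt T' x)
    (hne : ∀ ω ∈ S, T' ω ≠ 0) :
    ∃ (V : Set 𝕜) (g : 𝕜 → 𝕜), IsOpen V ∧ T x ∈ V ∧ (∀ᶠ ω in 𝓝 x, g (T ω) = ω) ∧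
      ∀ t ∈ V, g t ∈ S ∧ T (g t) = t ∧ HasDerivAt g (T' (g t))⁻¹ t := by
  have hstrict : HasStrictDerivAt T (T' x) x := hasStrictDerivAt_of_hasDerivAt_of_continuousAt
    ((hS.eventually_mem hx).mono hT) hT'
  let e := (hstrict.hasStrictFDerivAt_equiv (hne x hx)).toOpenPartialHomeomorph T
  have hcoe : (e : 𝕜 → 𝕜) = T := rfl
  have hxe : x ∈ e.source :=
    (hstrict.hasStrictFDerivAt_equiv (hne x hx)).mem_toOpenPartialHomeomorph_source
  refine ⟨e.target ∩ e.symm ⁻¹' S, e.symm, e.isOpen_inter_preimage_symm hS,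
    ⟨e.map_source hxe, ?_⟩, ?_, fun t ht => ?_⟩
  · change e.symm (e x) ∈ S
    rwa [e.left_inv hxe]
  · filter_upwards [e.open_source.mem_nhds hxe] with ω hω
    exact e.left_inv hω
  · refine ⟨ht.2, e.right_inv ht.1, ?_⟩
    refine HasDerivAt.of_local_left_inverse (f := T) (e.continuousAt_symm ht.1) (hT _ ht.2)
      (hne _ ht.2) ?_
    filter_upwards [e.open_target.mem_nhds ht.1] with s hs
    exact e.right_inv hs

/-- A holomorphic square root with a prescribed value. -/
theorem exists_sqrt_branch {c δ Y₁ R : ℂ} (hR : R ^ 2 = c * Y₁ ^ 4 - δ) (hR0 : R ≠ 0)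
    (hY : Y₁ ≠ 0) : ∃ (N : Set ℂ) (r : ℂ → ℂ), IsOpen N ∧ Y₁ ∈ N ∧ r Y₁ = R ∧
      (∀ Y ∈ N, Y ≠ 0 ∧ r Y ≠ 0 ∧ r Y ^ 2 = c * Y ^ 4 - δ) ∧ DifferentiableOn ℂ r N := by
  have hR2 : R ^ 2 ≠ 0 := pow_ne_zero 2 hR0
  have hcont : Continuous fun Y => (c * Y ^ 4 - δ) / R ^ 2 := by fun_prop
  -- Dividing by `R²` moves the value at `Y₁` to `1`, where the principal logarithm is holomorphic.
  refine ⟨{Y | Y ≠ 0} ∩ {Y | (c * Y ^ 4 - δ) / R ^ 2 ∈ Complex.slitPlane},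
    fun Y => R * Complex.exp (Complex.log ((c * Y ^ 4 - δ) / R ^ 2) / 2),
    isOpen_ne.inter (Complex.isOpen_slitPlane.preimage hcont), ⟨hY, ?_⟩, ?_, fun Y hY' => ?_, ?_⟩
  · rw [Set.mem_ofPred_eq, ← hR, div_self hR2]
    exact Complex.one_mem_slitPlane
  · dsimp only
    rw [← hR, div_self hR2]
    simp
  · refine ⟨hY'.1, mul_ne_zero hR0 (Complex.exp_ne_zero _), ?_⟩
    rw [mul_pow, ← Complex.exp_nat_mul, Nat.cast_ofNat, mul_div_cancel₀ _ two_ne_zero,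
      Complex.exp_log (Complex.slitPlane_ne_zero hY'.2), mul_div_cancel₀ _ hR2]
  · intro Y hY'
    have h1 : DifferentiableAt ℂ (fun Y => (c * Y ^ 4 - δ) / R ^ 2) Y := by fun_prop
    exact ((((h1.clog hY'.2).div_const 2).cexp).const_mul R).differentiableWithinAt

/-! ### The curve as a graph over complex time. -/

section Param

variable {L : PeriodPair} {c δ y₀ ω₀ : ℂ} (hδ : δ ≠ 0) (hy : quartic c δ y₀ = 0)
  (hL : HasInvariants L c y₀) (hb : IsBasePoint L c δ y₀ ω₀)

include hδ hy hL hb in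
theorem hasDerivAt_paramT {C D : ℂ} {U : Set ℂ} {Λ : ℂ → ℂ} (hU : IsOpen U)
    (hΛ : ContinuousOn Λ U) (hlog : ∀ ω ∈ U, IsLogValue L ω₀ C ω (Λ ω)) {ω : ℂ} (hω : ω ∈ U) :
    HasDerivAt (fun ω => paramT L c δ y₀ ω₀ C D (Λ ω) ω) (paramY L c δ y₀ C ω ^ 2) ω := by
  have hu : IsRegular L ω₀ (ω + C) := ⟨(hlog ω hω).1, (hlog ω hω).2.1, (hlog ω hω).2.2.1⟩
  have h1 := hasDerivAt_log_branch (hΛ.continuousAt (hU.mem_nhds hω))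
    ((hU.eventually_mem hω).mono fun z hz => (hlog z hz).2.2.2)
    (hasDerivAt_sigma_quotient hu)
  have h2 := (h1.const_mul (logCoeff L c δ y₀ ω₀)).add
    (hasDerivAt_paramT_zero hδ hy hL hb (D := D) hu)
  refine (h2.congr_deriv (by ring)).congr_of_eventuallyEq (Eventually.of_forall fun z => ?_)
  exact paramT_eq_add C D (Λ z) z

include hδ hy hL hb in
theorem paramT_graph {C D : ℂ} {U : Set ℂ} {Λ : ℂ → ℂ} (hU : IsOpen U)
    (hΛ : ContinuousOn Λ U) (hlog : ∀ ω ∈ U, IsLogValue L ω₀ C ω (Λ ω)) {ω₁ : ℂ} (hω₁ : ω₁ ∈ U)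
    (hY : paramY L c δ y₀ C ω₁ ≠ 0) (hq : quartic c δ (paramY L c δ y₀ C ω₁) ≠ 0) :
    ∃ (V N : Set ℂ) (r y : ℂ → ℂ), IsOpen V ∧ IsOpen N ∧
      paramT L c δ y₀ ω₀ C D (Λ ω₁) ω₁ ∈ V ∧
      (∀ᶠ ω in 𝓝 ω₁, y (paramT L c δ y₀ ω₀ C D (Λ ω) ω) = paramY L c δ y₀ C ω) ∧
      (∀ Y ∈ N, Y ≠ 0 ∧ r Y ≠ 0 ∧ r Y ^ 2 = c * Y ^ 4 - δ) ∧ DifferentiableOn ℂ r N ∧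
      ChielliniOn (-2) (damping δ r) (restoring δ) N ∧
      ∀ t ∈ V, y t ∈ N ∧ HasDerivAt y (r (y t) / y t ^ 2) t ∧
        deriv y t ^ 2 = c - δ * (y t ^ 4)⁻¹ ∧ SolvesDampedAt δ (damping δ r) y t := by
  have hreg : ∀ ω ∈ U, IsRegular L ω₀ (ω + C) := fun ω hω =>
    ⟨(hlog ω hω).1, (hlog ω hω).2.1, (hlog ω hω).2.2.1⟩
  have hsq := fun ω (hω : ω ∈ U) => paramVelocity_sq hδ hy hL hb (hreg ω hω)
  have hdY := fun ω (hω : ω ∈ U) => hasDerivAt_paramY hδ hy hL hb (hreg ω hω)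
  have hW0 : paramVelocity L c y₀ (ω₁ + C) ≠ 0 := by
    intro h
    have := hsq ω₁ hω₁
    rw [h] at this
    exact hq (by rw [quartic, ← this]; ring)
  obtain ⟨N, r, hN, hY₁, hrY, hr, hrd⟩ := exists_sqrt_branch (hsq ω₁ hω₁) hW0 hY
  have hcY := (hdY ω₁ hω₁).continuousAt
  have hcr : ContinuousAt (fun ω => r (paramY L c δ y₀ C ω)) ω₁ :=
    ContinuousAt.comp (g := r) ((hrd.differentiableAt (hN.mem_nhds hY₁)).continuousAt) hcY
  have hev : ∀ᶠ ω in 𝓝 ω₁, ω ∈ U ∧ paramY L c δ y₀ C ω ∈ N ∧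
      paramVelocity L c y₀ (ω + C) = r (paramY L c δ y₀ C ω) := by
    -- Velocity and `r(Y)` are square roots of the same number. They agree at `ω₁`, so their sum
    -- stays nonzero nearby and rules out the opposite sign.
    have hsum := ((continuousAt_paramVelocity hδ hy hL hb (hreg ω₁ hω₁)).add hcr).eventually_ne
      (y := 0) (by
        simp only [Pi.add_apply]
        rw [hrY, ← two_mul]
        exact mul_ne_zero two_ne_zero hW0)
    filter_upwards [hU.mem_nhds hω₁, hcY.eventually (hN.mem_nhds hY₁), hsum] with ω h1 h2 h3
    refine ⟨h1, h2, ?_⟩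
    have h4 := (hsq ω h1).trans (hr _ h2).2.2.symm
    have h5 : (paramVelocity L c y₀ (ω + C) - r (paramY L c δ y₀ C ω)) *
        (paramVelocity L c y₀ (ω + C) + r (paramY L c δ y₀ C ω)) = 0 := by
      linear_combination h4
    exact sub_eq_zero.1 ((mul_eq_zero.1 h5).resolve_right h3)
  obtain ⟨S, hS, hSo, hS₁⟩ := eventually_nhds_iff.1 hev
  obtain ⟨V, g, hV, hTV, hg, hgV⟩ := exists_local_inverse hSo hS₁
    (fun ω hω => hasDerivAt_paramT hδ hy hL hb (D := D) hU hΛ hlog (hS ω hω).1)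
    (hcY.pow 2) (fun ω hω => pow_ne_zero 2 (hr _ (hS ω hω).2.1).1)
  have hyd : ∀ t ∈ V, HasDerivAt (fun t => paramY L c δ y₀ C (g t))
      (r (paramY L c δ y₀ C (g t)) / paramY L c δ y₀ C (g t) ^ 2) t := by
    intro t ht
    obtain ⟨h1, -, h3⟩ := hgV t ht
    have h4 := (hdY _ (hS _ h1).1).comp t h3
    rw [(hS _ h1).2.2, ← div_eq_mul_inv] at h4
    exact h4
  have hrdiff : ∀ Y ∈ N, DifferentiableAt ℂ r Y := fun Y h => hrd.differentiableAt (hN.mem_nhds h)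
  have hrsq : ∀ Y ∈ N, ∀ᶠ x in 𝓝 Y, r x ^ 2 = c * x ^ 4 - δ := fun Y h =>
    (hN.eventually_mem h).mono fun x hx => (hr x hx).2.2
  refine ⟨V, N, r, fun t => paramY L c δ y₀ C (g t), hV, hN, hTV, ?_, hr, hrd, ?_, fun t ht => ?_⟩
  · exact hg.mono fun ω hω => congrArg (paramY L c δ y₀ C) hω
  · exact fun Y h => chiellini_of_sq_eq hδ (hr Y h).1 (hrdiff Y h) (hrsq Y h) (hr Y h).2.1
  · have hmem := (hS _ (hgV t ht).1).2.1
    obtain ⟨h0, hr0, hr2⟩ := hr _ hmem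
    refine ⟨hmem, hyd t ht, ?_, ?_⟩
    · rw [(hyd t ht).deriv, div_pow, hr2]
      field_simp
    · refine solvesDampedAt_of_hasDerivAt ?_ h0 (hrdiff _ hmem) (hrsq _ hmem) hr0
      filter_upwards [hV.mem_nhds ht] with s hs
      exact hyd s hs

end Param

/-! ### Real arcs of the curve solve the real equation. -/

theorem hasDerivAt_of_ofReal {f : ℝ → ℝ} {w : ℂ} {x : ℝ}
    (h : HasDerivAt (fun x => (f x : ℂ)) w x) : HasDerivAt f w.re x ∧ w = (w.re : ℂ) := by
  have h1 : HasDerivAt f w.re x := Complex.reCLM.hasFDerivAt.comp_hasDerivAt x h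
  exact ⟨h1, h.unique h1.ofReal_comp⟩

section RealCurve

variable {c δ : ℝ} {L : PeriodPair} {y₀ ω₀ : ℂ} (hδ : (δ : ℂ) ≠ 0) (hy : quartic c δ y₀ = 0)
  (hL : HasInvariants L c y₀) (hb : IsBasePoint L c δ y₀ ω₀)

include hδ hy hL hb in
theorem hasDerivAt_paramT_real {C D : ℂ} {I : Set ℝ} {Λ : ℝ → ℂ} (hI : IsOpen I)
    (hΛ : ContinuousOn Λ I) (hlog : ∀ ω ∈ I, IsLogValue L ω₀ C ω (Λ ω)) {ω : ℝ} (hω : ω ∈ I) :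
    HasDerivAt (fun ω : ℝ => paramT L c δ y₀ ω₀ C D (Λ ω) ω) (paramY L c δ y₀ C ω ^ 2) ω := by
  have hu : IsRegular L ω₀ (ω + C) := ⟨(hlog ω hω).1, (hlog ω hω).2.1, (hlog ω hω).2.2.1⟩
  have h1 := hasDerivAt_log_branch_real (hΛ.continuousAt (hI.mem_nhds hω))
    ((hI.eventually_mem hω).mono fun z hz => (hlog z hz).2.2.2)
    (hasDerivAt_sigma_quotient hu).comp_ofReal
  have h2 := (h1.const_mul (logCoeff L c δ y₀ ω₀)).add
    (hasDerivAt_paramT_zero hδ hy hL hb (D := D) hu).comp_ofReal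
  refine (h2.congr_deriv (by ring)).congr_of_eventuallyEq (Eventually.of_forall fun z => ?_)
  exact paramT_eq_add C D (Λ z) z

include hδ hy hL hb in
theorem realCurve_solves {C D : ℂ} {I : Set ℝ} {Λ : ℝ → ℂ} {τ η : ℝ → ℝ} (hI : IsOpen I)
    (hI' : IsPreconnected I) (hcurve : IsRealCurve L c δ y₀ ω₀ C D I Λ τ η)
    (hη : ∀ ω ∈ I, η ω ≠ 0 ∧ c * η ω ^ 4 - δ ≠ 0) :
    StrictMonoOn τ I ∧ IsOpen (τ '' I) ∧ ∃ ε : ℝ, (ε = 1 ∨ ε = -1) ∧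
      ∀ y : ℝ → ℝ, (∀ ω ∈ I, y (τ ω) = η ω) → ∀ t ∈ τ '' I, 0 < c * y t ^ 4 - δ ∧
        HasDerivAt y (ε * √(c - δ * (y t ^ 4)⁻¹)) t ∧
        SolvesDampedAt δ (damping δ (fun x => ε * √(c * x ^ 4 - δ))) y t := by
  obtain ⟨hΛ, hval⟩ := hcurve
  have hlog := fun ω hω => (hval ω hω).1
  have hreg : ∀ ω ∈ I, IsRegular L ω₀ (ω + C) := fun ω hω =>
    ⟨(hlog ω hω).1, (hlog ω hω).2.1, (hlog ω hω).2.2.1⟩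
  have hdτ : ∀ ω ∈ I, HasDerivAt τ (η ω ^ 2) ω := by
    intro ω hω
    have h1 := (hasDerivAt_paramT_real hδ hy hL hb (D := D) hI hΛ hlog hω).congr_of_eventuallyEq
      (f₁ := fun x => (τ x : ℂ)) (by
        filter_upwards [hI.mem_nhds hω] with x hx using (hval x hx).2.1)
    have h2 := (hasDerivAt_of_ofReal h1).1
    rw [← (hval ω hω).2.2] at h2
    exact_mod_cast h2
  set v : ℝ → ℝ := fun ω => (paramVelocity L c y₀ (ω + C)).re with hv
  have hdη : ∀ ω ∈ I, HasDerivAt η (v ω) ω ∧ v ω ^ 2 = c * η ω ^ 4 - δ := by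
    intro ω hω
    have h1 := (hasDerivAt_paramY hδ hy hL hb (hreg ω hω)).comp_ofReal.congr_of_eventuallyEq
      (f₁ := fun x => (η x : ℂ)) (by
        filter_upwards [hI.mem_nhds hω] with x hx using (hval x hx).2.2)
    obtain ⟨h2, h3⟩ := hasDerivAt_of_ofReal h1
    refine ⟨h2, ?_⟩
    have h4 := paramVelocity_sq hδ hy hL hb (hreg ω hω)
    rw [h3, ← (hval ω hω).2.2] at h4
    exact_mod_cast h4
  -- The quartic equals the square of the real velocity `v`, so nonvanishing already means positive.
  have hpos : ∀ ω ∈ I, 0 < c * η ω ^ 4 - δ := fun ω hω => by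
    have h1 := (hη ω hω).2
    rw [← (hdη ω hω).2] at h1 ⊢
    positivity
  have hcη : ContinuousOn η I := fun ω hω => (hdη ω hω).1.continuousAt.continuousWithinAt
  have hcv : ContinuousOn v I := fun ω hω => by
    have h1 : ContinuousAt (fun x : ℝ => paramVelocity L c y₀ (x + C)) ω :=
      ContinuousAt.comp (f := fun x : ℝ => (x : ℂ))
        (g := fun x : ℂ => paramVelocity L c y₀ (x + C))
        (continuousAt_paramVelocity hδ hy hL hb (hreg ω hω)) Complex.continuous_ofReal.continuousAt
    exact (Complex.continuous_re.continuousAt.comp h1).continuousWithinAt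
  have hε : ∃ ε : ℝ, (ε = 1 ∨ ε = -1) ∧ ∀ ω ∈ I, v ω = ε * √(c * η ω ^ 4 - δ) := by
    rcases hI'.eq_or_eq_neg_of_sq_eq hcv
      (g := fun ω => √(c * η ω ^ 4 - δ)) (by fun_prop) (fun ω hω => by
        simp only [Pi.pow_apply]
        rw [Real.sq_sqrt (hpos ω hω).le, (hdη ω hω).2])
      (fun {ω} hω => (Real.sqrt_pos.2 (hpos ω hω)).ne') with h | h
    · exact ⟨1, Or.inl rfl, fun ω hω => by rw [h hω, one_mul]⟩
    · exact ⟨-1, Or.inr rfl, fun ω hω => by rw [h hω, neg_one_mul]; rfl⟩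
  obtain ⟨ε, hε1, hε2⟩ := hε
  have hinv := fun ω (hω : ω ∈ I) => exists_local_inverse hI hω hdτ
    ((hcη.continuousAt (hI.mem_nhds hω)).pow 2) (fun ω hω => pow_ne_zero 2 (hη ω hω).1)
  have hopen : IsOpen (τ '' I) := by
    rw [isOpen_iff_mem_nhds]
    rintro _ ⟨ω, hω, rfl⟩
    obtain ⟨V, g, hV, hTV, -, hgV⟩ := hinv ω hω
    filter_upwards [hV.mem_nhds hTV] with t ht
    exact ⟨g t, (hgV t ht).1, (hgV t ht).2.1⟩
  refine ⟨?_, hopen, ε, hε1, fun y hyη => ?_⟩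
  · refine strictMonoOn_of_deriv_pos hI'.ordConnected.convex
      (fun ω hω => (hdτ ω hω).continuousAt.continuousWithinAt) fun ω hω => ?_
    have hω' := interior_subset hω
    rw [(hdτ ω hω').deriv]
    have := (hη ω hω').1
    positivity
  · have hall : ∀ t ∈ τ '' I, y t ≠ 0 ∧ 0 < c * y t ^ 4 - δ ∧
        HasDerivAt y (ε * √(c - δ * (y t ^ 4)⁻¹)) t := by
      rintro _ ⟨ω, hω, rfl⟩
      rw [hyη ω hω]
      refine ⟨(hη ω hω).1, hpos ω hω, ?_⟩
      obtain ⟨V, g, hV, hTV, hg, hgV⟩ := hinv ω hω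
      have h1 : g (τ ω) = ω := hg.self_of_nhds
      have h2 := (hgV _ hTV).2.2
      rw [h1] at h2
      have h3 : HasDerivAt η (v ω) (g (τ ω)) := by rw [h1]; exact (hdη ω hω).1
      have h4 := h3.comp (τ ω) h2
      rw [sqrt_sub_mul_inv c δ (hη ω hω).1, ← mul_div_assoc, ← hε2 ω hω, div_eq_mul_inv]
      refine h4.congr_of_eventuallyEq ?_
      filter_upwards [hV.mem_nhds hTV] with t ht
      obtain ⟨h5, h6, -⟩ := hgV t ht
      rw [Function.comp_apply, ← hyη _ h5, h6]
    intro t ht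
    exact ⟨(hall t ht).2.1, (hall t ht).2.2, solvesDampedAt_real hε1 hopen hall ht⟩

end RealCurve

/-! ### Every real solution is an arc of the curve. -/

theorem exists_antiderivative {E : Type*} [NormedAddCommGroup E] [NormedSpace ℝ E]
    [CompleteSpace E] {I : Set ℝ} {f : ℝ → E} (hI : IsOpen I) (hI' : IsPreconnected I)
    (hf : ContinuousOn f I) : ∃ F : ℝ → E, ∀ x ∈ I, HasDerivAt F (f x) x := by
  rcases I.eq_empty_or_nonempty with rfl | ⟨a, ha⟩
  · exact ⟨0, fun _ h => h.elim⟩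
  refine ⟨fun x => ∫ s in a..x, f s, fun x hx => ?_⟩
  exact intervalIntegral.integral_hasDerivAt_right
    (hf.mono (hI'.ordConnected.uIcc_subset ha hx)).intervalIntegrable
    (hf.stronglyMeasurableAtFilter hI x hx) (hf.continuousAt (hI.mem_nhds hx))

theorem eq_on_of_deriv_eq {E : Type*} [NormedAddCommGroup E] [NormedSpace ℝ E] {I : Set ℝ}
    {f : ℝ → E} (hI : IsOpen I) (hI' : IsPreconnected I) (hf : ∀ x ∈ I, HasDerivAt f 0 x)
    {a b : ℝ} (ha : a ∈ I) (hb : b ∈ I) : f a = f b :=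
  hI.is_const_of_deriv_eq_zero hI' (fun x hx => (hf x hx).differentiableAt.differentiableWithinAt)
    (fun x hx => (hf x hx).deriv) ha hb

/-- The change of the parameter `dω = dt / y²`. -/
theorem exists_reparametrization {J : Set ℝ} {y : ℝ → ℝ} (hJ : IsOpen J) (hJ' : IsPreconnected J)
    (hy : ContinuousOn y J) (h0 : ∀ t ∈ J, y t ≠ 0) :
    ∃ (I : Set ℝ) (τ : ℝ → ℝ), IsOpen I ∧ IsPreconnected I ∧ τ '' I = J ∧
      ∀ ω ∈ I, HasDerivAt τ (y (τ ω) ^ 2) ω := by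
  have hcont : ContinuousOn (fun t => (y t ^ 2)⁻¹) J :=
    (hy.pow 2).inv₀ fun t ht => pow_ne_zero 2 (h0 t ht)
  -- The new parameter is `s = ∫ dt/y²`, strictly increasing; `τ` is its inverse.
  obtain ⟨s, hs⟩ := exists_antiderivative hJ hJ' hcont
  have hmono : StrictMonoOn s J := by
    refine strictMonoOn_of_deriv_pos hJ'.ordConnected.convex
      (fun t ht => (hs t ht).continuousAt.continuousWithinAt) fun t ht => ?_
    have ht' := interior_subset ht
    rw [(hs t ht').deriv]
    have := h0 t ht'
    positivity
  have hτ : ∀ t ∈ J, Function.invFunOn s J (s t) = t := fun t ht =>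
    hmono.injOn.leftInvOn_invFunOn ht
  have hinv := fun t (ht : t ∈ J) => exists_local_inverse hJ ht hs
    (hcont.continuousAt (hJ.mem_nhds ht)) fun t ht => inv_ne_zero (pow_ne_zero 2 (h0 t ht))
  refine ⟨s '' J, Function.invFunOn s J, ?_, ?_, ?_, ?_⟩
  · rw [isOpen_iff_mem_nhds]
    rintro _ ⟨t, ht, rfl⟩
    obtain ⟨V, g, hV, hTV, -, hgV⟩ := hinv t ht
    filter_upwards [hV.mem_nhds hTV] with ω hω
    exact ⟨g ω, (hgV ω hω).1, (hgV ω hω).2.1⟩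
  · exact hJ'.image s fun t ht => (hs t ht).continuousAt.continuousWithinAt
  · ext t
    constructor
    · rintro ⟨_, ⟨t', ht', rfl⟩, rfl⟩
      rwa [hτ t' ht']
    · exact fun ht => ⟨s t, ⟨t, ht, rfl⟩, hτ t ht⟩
  · rintro _ ⟨t, ht, rfl⟩
    obtain ⟨V, g, hV, hTV, hg, hgV⟩ := hinv t ht
    have h1 := (hgV _ hTV).2.2
    rw [hg.self_of_nhds, inv_inv] at h1
    rw [hτ t ht]
    refine h1.congr_of_eventuallyEq ?_
    filter_upwards [hV.mem_nhds hTV] with ω hω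
    obtain ⟨h2, h3, -⟩ := hgV ω hω
    rw [← h3, hτ _ h2, h3]

/-- A solution of the second-order equation of the Weierstrass function is a translate of it. -/
theorem eq_weierstrassP_of_hasDerivAt {L : PeriodPair} {C : ℂ} {I : Set ℝ} {p q : ℝ → ℂ}
    (hI : IsOpen I) (hI' : IsPreconnected I) (hp : ∀ ω ∈ I, HasDerivAt p (q ω) ω)
    (hq : ∀ ω ∈ I, HasDerivAt q (6 * p ω ^ 2 - L.g₂ / 2) ω) {ω₁ : ℝ} (hω₁ : ω₁ ∈ I)
    (hL : (ω₁ : ℂ) + C ∉ L.lattice) (hp₁ : p ω₁ = L.weierstrassP (ω₁ + C))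
    (hq₁ : q ω₁ = L.derivWeierstrassP (ω₁ + C)) :
    ∀ ω ∈ I, (ω : ℂ) + C ∉ L.lattice ∧ p ω = L.weierstrassP (ω + C) := by
  -- The set where both solutions and their derivatives coincide is nonempty, open by ODE
  -- uniqueness, and relatively closed in the connected set `I`.
  set A : Set ℝ := {ω | ω ∈ I ∧ (ω : ℂ) + C ∉ L.lattice ∧ p ω = L.weierstrassP (ω + C) ∧
    q ω = L.derivWeierstrassP (ω + C)} with hA
  have hshift : Continuous fun ω : ℝ => (ω : ℂ) + C := by fun_prop
  have hdP : ∀ ω : ℝ, (ω : ℂ) + C ∉ L.lattice → HasDerivAt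
      (fun ω : ℝ => L.weierstrassP (ω + C)) (L.derivWeierstrassP (ω + C)) ω := fun ω hω =>
    ((L.hasDerivAt_weierstrassP hω).comp_add_const (ω : ℂ) C).comp_ofReal
  have hdP' : ∀ ω : ℝ, (ω : ℂ) + C ∉ L.lattice → HasDerivAt
      (fun ω : ℝ => L.derivWeierstrassP (ω + C)) (6 * L.weierstrassP (ω + C) ^ 2 - L.g₂ / 2) ω := by
    intro ω hω
    rw [← L.deriv_derivWeierstrassP hω]
    exact ((L.hasDerivAt_derivWeierstrassP hω).comp_add_const (ω : ℂ) C).comp_ofReal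
  have hopen : IsOpen A := by
    rw [isOpen_iff_mem_nhds]
    rintro ω ⟨hωI, hωL, hωp, hωq⟩
    let v : ℂ × ℂ → ℂ × ℂ := fun x => (x.2, 6 * x.1 ^ 2 - L.g₂ / 2)
    have hv : ContDiffAt ℝ 1 v (p ω, q ω) := by
      have : ContDiff ℝ 1 v := by fun_prop
      exact this.contDiffAt
    obtain ⟨K, s, hs, hK⟩ := hv.exists_lipschitzOnWith
    have hI1 := hI.eventually_mem hωI
    have hL1 := hshift.continuousAt.eventually (L.isOpen_compl_lattice.mem_nhds hωL)
    have hd1 : ∀ x ∈ I, HasDerivAt (fun x => (p x, q x)) (v (p x, q x)) x := fun x hx =>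
      (hp x hx).prodMk (hq x hx)
    have hd2 : ∀ x : ℝ, (x : ℂ) + C ∉ L.lattice → HasDerivAt
        (fun x : ℝ => (L.weierstrassP (x + C), L.derivWeierstrassP (x + C)))
        (v (L.weierstrassP (x + C), L.derivWeierstrassP (x + C))) x := fun x hx =>
      (hdP x hx).prodMk (hdP' x hx)
    have heq0 : (p ω, q ω) = (L.weierstrassP (ω + C), L.derivWeierstrassP (ω + C)) := by
      rw [hωp, hωq]
    have hs2 : s ∈ 𝓝 (L.weierstrassP (ω + C), L.derivWeierstrassP (ω + C)) := heq0 ▸ hs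
    have heq := ODE_solution_unique_of_eventually (v := fun _ => v) (s := fun _ => s) (K := K)
      (t₀ := ω) (f := fun x => (p x, q x))
      (g := fun x : ℝ => (L.weierstrassP (x + C), L.derivWeierstrassP (x + C)))
      (Eventually.of_forall fun _ => hK)
      ((hI1.and ((hd1 ω hωI).continuousAt.eventually_mem hs)).mono
        fun x hx => ⟨hd1 x hx.1, hx.2⟩)
      ((hL1.and ((hd2 ω hωL).continuousAt.eventually_mem hs2)).mono
        fun x hx => ⟨hd2 x hx.1, hx.2⟩) heq0
    filter_upwards [hI1, hL1, heq] with x h1 h2 h3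
    exact ⟨h1, h2, (Prod.ext_iff.1 h3).1, (Prod.ext_iff.1 h3).2⟩
  have hclosed : closure A ∩ I ⊆ A := by
    rintro ω ⟨hω, hωI⟩
    have hfreq := mem_closure_iff_frequently.1 hω
    -- A limit point of `A` in `I` cannot be a pole: `p` stays bounded near it, whereas `℘` blows
    -- up.
    have hωL : (ω : ℂ) + C ∉ L.lattice := by
      intro hmem
      have hlim : Tendsto (fun x : ℝ => (x : ℂ) + C) (𝓝[≠] ω) (𝓝[≠] (ω + C)) := by
        refine tendsto_nhdsWithin_iff.2 ⟨hshift.continuousAt.tendsto.mono_left nhdsWithin_le_nhds, ?_⟩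
        filter_upwards [self_mem_nhdsWithin] with x hx
        simpa using hx
      have h1 := (tendsto_norm_cobounded_atTop.comp
        ((L.tendsto_weierstrassP_cobounded hmem).comp hlim)).eventually_gt_atTop (‖p ω‖ + 1)
      rw [eventually_nhdsWithin_iff] at h1
      have h2 : ∀ᶠ x in 𝓝 ω, ‖p x‖ < ‖p ω‖ + 1 :=
        (hp ω hωI).continuousAt.norm.eventually (gt_mem_nhds (lt_add_one _))
      obtain ⟨x, ⟨-, hxL, hxp, -⟩, h3, h4⟩ := (hfreq.and_eventually (h1.and h2)).exists
      have hne : x ≠ ω := by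
        rintro rfl
        exact hxL hmem
      have h5 := h3 hne
      simp only [Function.comp_apply] at h5
      rw [← hxp] at h5
      exact lt_asymm h4 h5
    have hfinish : ∀ {f g : ℝ → ℂ}, ContinuousAt f ω → ContinuousAt g ω →
        (∀ x ∈ A, f x = g x) → f ω = g ω := by
      intro f g hf hg h
      by_contra hne
      obtain ⟨x, hx, hx'⟩ := (hfreq.and_eventually
        ((hf.sub hg).eventually_ne (y := 0) (sub_ne_zero.2 hne))).exists
      exact hx' (sub_eq_zero.2 (h x hx))
    exact ⟨hωI, hωL, hfinish (hp ω hωI).continuousAt (hdP ω hωL).continuousAt fun x hx => hx.2.2.1,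
      hfinish (hq ω hωI).continuousAt (hdP' ω hωL).continuousAt fun x hx => hx.2.2.2⟩
  intro ω hω
  have := hI'.subset_of_closure_inter_subset hopen ⟨ω₁, hω₁, hω₁, hL, hp₁, hq₁⟩ hclosed hω
  exact ⟨this.2.1, this.2.2.1⟩

section RealCurve

variable {c δ : ℝ} {L : PeriodPair} {y₀ ω₀ : ℂ} (hδ : (δ : ℂ) ≠ 0) (hy : quartic c δ y₀ = 0)
  (hL : HasInvariants L c y₀) (hb : IsBasePoint L c δ y₀ ω₀)

include hδ hy hL hb in
/-- A solution of the first-order equation in the parameter `ω` is given by `paramY`. -/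
theorem exists_shift {I : Set ℝ} {η w : ℝ → ℝ} (hI : IsOpen I) (hI' : IsPreconnected I)
    {ω₁ : ℝ} (hω₁ : ω₁ ∈ I) (hη : ∀ ω ∈ I, HasDerivAt η (w ω) ω)
    (hw : ∀ ω ∈ I, HasDerivAt w (2 * c * η ω ^ 3) ω)
    (hsq : ∀ ω ∈ I, w ω ^ 2 = c * η ω ^ 4 - δ) (hpos : ∀ ω ∈ I, 0 < c * η ω ^ 4 - δ) :
    ∃ C : ℂ, ∀ ω ∈ I, IsRegular L ω₀ (ω + C) ∧ (η ω : ℂ) = paramY L c δ y₀ C ω := by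
  obtain ⟨hc, hy0⟩ := coeff_ne_zero hδ hy
  have hδ' : (δ : ℂ) = c * y₀ ^ 4 := by rw [quartic] at hy; linear_combination -hy
  have hne : ∀ ω ∈ I, (η ω : ℂ) - y₀ ≠ 0 := by
    intro ω hω h
    have h1 : ((c * η ω ^ 4 - δ : ℝ) : ℂ) = 0 := by
      push_cast
      rw [sub_eq_zero.1 h, hδ', sub_self]
    exact (hpos ω hω).ne' (by exact_mod_cast h1)
  have hk : (c : ℂ) * y₀ ^ 3 ≠ 0 := mul_ne_zero hc (pow_ne_zero 3 hy0)
  -- `p` is the inverse of the Möbius map in `paramY` applied to `η`, and `q` is its derivative.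
  set p : ℝ → ℂ := fun ω => c * y₀ ^ 2 / 2 + c * y₀ ^ 3 * ((η ω : ℂ) - y₀)⁻¹ with hp
  set q : ℝ → ℂ := fun ω => -(c * y₀ ^ 3) * (w ω / ((η ω : ℂ) - y₀) ^ 2) with hq
  have hsq' : ∀ ω ∈ I, (w ω : ℂ) ^ 2 = c * (η ω : ℂ) ^ 4 - c * y₀ ^ 4 := fun ω hω => by
    rw [← hδ']
    exact_mod_cast hsq ω hω
  have hdη : ∀ ω ∈ I, HasDerivAt (fun ω => (η ω : ℂ) - y₀) (w ω) ω := fun ω hω =>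
    (hη ω hω).ofReal_comp.sub_const y₀
  have hdp : ∀ ω ∈ I, HasDerivAt p (q ω) ω := by
    intro ω hω
    have h1 := (((hdη ω hω).inv (hne ω hω)).const_mul (c * y₀ ^ 3 : ℂ)).const_add
      (c * y₀ ^ 2 / 2 : ℂ)
    refine h1.congr_deriv ?_
    simp only [hq]
    ring
  have hdq : ∀ ω ∈ I, HasDerivAt q (6 * p ω ^ 2 - L.g₂ / 2) ω := by
    intro ω hω
    have h1 := ((hw ω hω).ofReal_comp.div ((hdη ω hω).pow 2)
      (pow_ne_zero 2 (hne ω hω))).const_mul (-(c * y₀ ^ 3) : ℂ)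
    refine h1.congr_deriv ?_
    rw [g₂_eq hL]
    have h2 := hsq' ω hω
    have h3 := hne ω hω
    have e : (η ω : ℂ) = ((η ω : ℂ) - y₀) + y₀ := by ring
    simp only [hp, Pi.pow_apply]
    push_cast
    rw [e] at h2
    generalize (η ω : ℂ) - y₀ = x at *
    rw [e]
    field_simp
    linear_combination 8 * h2
  have hq2 : q ω₁ ^ 2 = 4 * p ω₁ ^ 3 - L.g₂ * p ω₁ := by
    rw [g₂_eq hL]
    have h2 := hsq' ω₁ hω₁
    have h3 := hne ω₁ hω₁
    have e : (η ω₁ : ℂ) = ((η ω₁ : ℂ) - y₀) + y₀ := by ring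
    simp only [hp, hq]
    rw [mul_pow, div_pow, h2]
    rw [e]
    generalize (η ω₁ : ℂ) - y₀ = x at *
    rw [add_sub_cancel_right]
    field_simp
    ring
  -- The cubic relation fixes `℘'(u)` up to sign; passing to `-u` corrects the sign without changing
  -- `℘(u)`.
  obtain ⟨u, hu, hup, huq⟩ : ∃ u, u ∉ L.lattice ∧ L.weierstrassP u = p ω₁ ∧
      L.derivWeierstrassP u = q ω₁ := by
    obtain ⟨u, hu, hup⟩ := L.exists_weierstrassP_eq (p ω₁)
    have h1 := L.derivWeierstrassP_sq u hu
    rw [g₃_eq hL, hup, sub_zero, ← hq2] at h1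
    rcases sq_eq_sq_iff_eq_or_eq_neg.1 h1 with h | h
    · exact ⟨u, hu, hup, h⟩
    · refine ⟨-u, by simpa using hu, by rw [L.weierstrassP_neg, hup], ?_⟩
      rw [L.derivWeierstrassP_neg, h, neg_neg]
  have hC : (ω₁ : ℂ) + (u - ω₁) = u := by ring
  have hall := eq_weierstrassP_of_hasDerivAt (C := u - ω₁) hI hI' hdp hdq hω₁ (by rwa [hC])
    (by rw [hC, hup]) (by rw [hC, huq])
  refine ⟨u - ω₁, fun ω hω => ?_⟩
  obtain ⟨h1, h2⟩ := hall ω hω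
  set z := (ω : ℂ) + (u - ω₁) with hz
  -- `p` never takes the value that corresponds to `Y = ∞`, so `z` is not congruent to `±ω₀`.
  have hbase : L.weierstrassP z ≠ L.weierstrassP ω₀ := by
    rw [← h2, weierstrassP_base hb]
    simp only [hp]
    intro h
    exact mul_ne_zero hk (inv_ne_zero (hne ω hω)) (by linear_combination h)
  refine ⟨⟨h1, fun h => hbase ?_, fun h => hbase ?_⟩, ?_⟩
  · have := L.weierstrassP_sub_coe z ⟨z + ω₀, h⟩
    rw [← this, show z - (z + ω₀) = -ω₀ by ring, L.weierstrassP_neg]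
  · have := L.weierstrassP_sub_coe z ⟨z - ω₀, h⟩
    rw [← this, show z - (z - ω₀) = ω₀ by ring]
  · rw [paramY_eq, ← hz, ← h2]
    simp only [hp]
    rw [add_sub_cancel_left, div_mul_cancel_left₀ hk, inv_inv]
    ring

include hδ hy hL hb in
theorem exists_realCurve {ε : ℝ} {J : Set ℝ} {y : ℝ → ℝ} (hε : ε = 1 ∨ ε = -1) (hJ : IsOpen J)
    (hJ' : IsPreconnected J) (hsol : ∀ t ∈ J, y t ≠ 0 ∧ 0 < c * y t ^ 4 - δ ∧
      HasDerivAt y (ε * √(c - δ * (y t ^ 4)⁻¹)) t) :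
    ∃ (C D : ℂ) (I : Set ℝ) (Λ : ℝ → ℂ) (τ η : ℝ → ℝ), IsOpen I ∧ IsPreconnected I ∧
      IsRealCurve L c δ y₀ ω₀ C D I Λ τ η ∧ τ '' I = J ∧ ∀ ω ∈ I, y (τ ω) = η ω := by
  obtain ⟨I, τ, hI, hI', hIJ, hτ⟩ := exists_reparametrization hJ hJ'
    (fun t ht => (hsol t ht).2.2.continuousAt.continuousWithinAt) fun t ht => (hsol t ht).1
  have hmem : ∀ ω ∈ I, τ ω ∈ J := fun ω hω => hIJ ▸ ⟨ω, hω, rfl⟩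
  rcases I.eq_empty_or_nonempty with hempty | ⟨ω₁, hω₁⟩
  · refine ⟨0, 0, I, 0, τ, y ∘ τ, hI, hI', ⟨?_, ?_⟩, hIJ, fun _ _ => rfl⟩ <;> simp [hempty]
  have hη : ∀ ω ∈ I, HasDerivAt (y ∘ τ) (ε * √(c * y (τ ω) ^ 4 - δ)) ω := by
    intro ω hω
    obtain ⟨h0, -, hd⟩ := hsol _ (hmem ω hω)
    refine (hd.comp ω (hτ ω hω)).congr_deriv ?_
    rw [sqrt_sub_mul_inv c δ h0]
    field_simp
  have hw : ∀ ω ∈ I, HasDerivAt (fun ω => ε * √(c * y (τ ω) ^ 4 - δ))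
      (2 * c * y (τ ω) ^ 3) ω := by
    intro ω hω
    have hpos := (hsol _ (hmem ω hω)).2.1
    have h1 := hasDerivAt_of_sq_eq (c := c) (δ := δ) (differentiableAt_sign_mul_sqrt (ε := ε) hpos)
      ((eventually_quartic_pos hpos).mono fun x hx => sign_mul_sqrt_sq hε hx)
      (sign_mul_sqrt_ne_zero hε hpos)
    refine (h1.comp ω (hη ω hω)).congr_deriv ?_
    exact div_mul_cancel₀ _ (sign_mul_sqrt_ne_zero hε hpos)
  have hposI : ∀ ω ∈ I, 0 < c * y (τ ω) ^ 4 - δ := fun ω hω => (hsol _ (hmem ω hω)).2.1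
  obtain ⟨C, hC⟩ := exists_shift hδ hy hL hb hI hI' hω₁ hη hw
    (fun ω hω => sign_mul_sqrt_sq hε (hposI ω hω)) hposI
  have hζ : ContinuousOn (fun ω : ℝ => weierstrassZeta L (ω + C + ω₀) -
      weierstrassZeta L (ω + C - ω₀)) I := by
    intro ω hω
    obtain ⟨-, h1, h2⟩ := (hC ω hω).1
    have h3 : ContinuousAt (fun ω : ℝ => (ω : ℂ) + C + ω₀) ω := by fun_prop
    have h4 : ContinuousAt (fun ω : ℝ => (ω : ℂ) + C - ω₀) ω := by fun_prop
    exact ((ContinuousAt.comp (f := fun ω : ℝ => (ω : ℂ) + C + ω₀) (hasDerivAt_zeta L h1).continuousAt h3).sub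
      (ContinuousAt.comp (f := fun ω : ℝ => (ω : ℂ) + C - ω₀) (hasDerivAt_zeta L h2).continuousAt h4)).continuousWithinAt
  obtain ⟨F, hF⟩ := exists_antiderivative hI hI' hζ
  set Q : ℝ → ℂ := fun ω => weierstrassSigma L (ω + C + ω₀) / weierstrassSigma L (ω + C - ω₀)
    with hQ
  have hQ0 : ∀ ω ∈ I, Q ω ≠ 0 := fun ω hω => div_ne_zero
    (weierstrassSigma_ne_zero L (hC ω hω).1.2.1) (weierstrassSigma_ne_zero L (hC ω hω).1.2.2)
  -- `F` has the logarithmic derivative of `Q` as its derivative, so it is a logarithm of `Q` up to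
  -- the additive constant `log K`.
  have hconst : ∀ ω ∈ I, Complex.exp (-F ω) * Q ω = Complex.exp (-F ω₁) * Q ω₁ := fun ω hω =>
    eq_on_of_deriv_eq (f := fun ω => Complex.exp (-F ω) * Q ω) hI hI' (fun x hx => by
      have h1 := ((hF x hx).neg.cexp).mul (hasDerivAt_sigma_quotient (hC x hx).1).comp_ofReal
      refine h1.congr_deriv ?_
      simp only [Pi.neg_apply]
      ring) hω hω₁
  set K := Complex.exp (-F ω₁) * Q ω₁ with hK
  have hK0 : K ≠ 0 := mul_ne_zero (Complex.exp_ne_zero _) (hQ0 ω₁ hω₁)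
  set Λ : ℝ → ℂ := fun ω => F ω + Complex.log K with hΛ
  have hΛc : ContinuousOn Λ I := fun ω hω =>
    ((hF ω hω).continuousAt.add continuousAt_const).continuousWithinAt
  have hlog : ∀ ω ∈ I, IsLogValue L ω₀ C ω (Λ ω) := by
    intro ω hω
    refine ⟨(hC ω hω).1.1, (hC ω hω).1.2.1, (hC ω hω).1.2.2, ?_⟩
    rw [hΛ, Complex.exp_add, Complex.exp_log hK0, ← hconst ω hω, ← mul_assoc, ← Complex.exp_add,
      add_neg_cancel, Complex.exp_zero, one_mul]
  -- Both times have derivative `Y²`; their constant difference becomes `D`.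
  have hT : ∀ ω ∈ I, (τ ω : ℂ) - paramT L c δ y₀ ω₀ C 0 (Λ ω) ω =
      τ ω₁ - paramT L c δ y₀ ω₀ C 0 (Λ ω₁) ω₁ := fun ω hω =>
    eq_on_of_deriv_eq (f := fun ω : ℝ => (τ ω : ℂ) - paramT L c δ y₀ ω₀ C 0 (Λ ω) ω) hI hI'
      (fun x hx => by
        refine ((hτ x hx).ofReal_comp.sub
          (hasDerivAt_paramT_real hδ hy hL hb hI hΛc hlog hx)).congr_deriv ?_
        rw [← (hC x hx).2, Function.comp_apply]
        push_cast
        ring) hω hω₁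
  refine ⟨C, 0 + (τ ω₁ - paramT L c δ y₀ ω₀ C 0 (Λ ω₁) ω₁), I, Λ, τ, y ∘ τ, hI, hI',
    ⟨hΛc, fun ω hω => ⟨hlog ω hω, ?_, (hC ω hω).2⟩⟩, hIJ, fun _ _ => rfl⟩
  rw [paramT_add_const, ← hT ω hω]
  ring

end RealCurve

end MilnePinney

theorem mainTheorem2 :
    -- the Chiellini condition determines the damping and the first-order equation
    (∀ (δ : ℝ) (J : Set ℝ) (g : ℝ → ℝ), δ ≠ 0 → IsOpen J → IsPreconnected J → (0 : ℝ) ∉ J →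
      MilnePinney.ChielliniOn (-2) g (MilnePinney.restoring δ) J →
      ∃ c ε : ℝ, (ε = 1 ∨ ε = -1) ∧ ∀ Y ∈ J, 0 < c * Y ^ 4 - δ ∧
        MilnePinney.restoring δ Y / g Y = ε * √(c - δ * (Y ^ 4)⁻¹) ∧
        g Y = MilnePinney.damping δ (fun x => ε * √(c * x ^ 4 - δ)) Y) ∧
    -- conversely this damping satisfies the condition, and the first-order equation solves
    -- the damped equation
    (∀ δ c ε : ℝ, δ ≠ 0 → (ε = 1 ∨ ε = -1) →
      MilnePinney.ChielliniOn (-2) (MilnePinney.damping δ (fun x => ε * √(c * x ^ 4 - δ)))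
        (MilnePinney.restoring δ) {Y | Y ≠ 0 ∧ 0 < c * Y ^ 4 - δ} ∧
      ∀ (J : Set ℝ) (y : ℝ → ℝ), IsOpen J →
        (∀ t ∈ J, y t ≠ 0 ∧ 0 < c * y t ^ 4 - δ ∧
          HasDerivAt y (ε * √(c - δ * (y t ^ 4)⁻¹)) t) →
        ∀ t ∈ J, MilnePinney.SolvesDampedAt δ
          (MilnePinney.damping δ (fun x => ε * √(c * x ^ 4 - δ))) y t) ∧
    -- existence of the Weierstrass function and of the base point
    (∀ c δ y₀ : ℂ, δ ≠ 0 → MilnePinney.quartic c δ y₀ = 0 →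
      (∃ L : PeriodPair, MilnePinney.HasInvariants L c y₀) ∧
      ∀ L : PeriodPair, MilnePinney.HasInvariants L c y₀ →
        ∃ ω₀ : ℂ, MilnePinney.IsBasePoint L c δ y₀ ω₀) ∧
    -- the parametric formulas solve the equation, for complex constants and complex time
    (∀ (c δ y₀ : ℂ) (L : PeriodPair) (ω₀ C D : ℂ) (U : Set ℂ) (Λ : ℂ → ℂ),
      δ ≠ 0 → MilnePinney.quartic c δ y₀ = 0 → MilnePinney.HasInvariants L c y₀ →
      MilnePinney.IsBasePoint L c δ y₀ ω₀ → IsOpen U → ContinuousOn Λ U →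
      (∀ ω ∈ U, MilnePinney.IsLogValue L ω₀ C ω (Λ ω)) →
      ∀ ω₁ ∈ U, MilnePinney.paramY L c δ y₀ C ω₁ ≠ 0 →
        MilnePinney.quartic c δ (MilnePinney.paramY L c δ y₀ C ω₁) ≠ 0 →
        ∃ (V N : Set ℂ) (r y : ℂ → ℂ), IsOpen V ∧ IsOpen N ∧
          MilnePinney.paramT L c δ y₀ ω₀ C D (Λ ω₁) ω₁ ∈ V ∧
          (∀ᶠ ω in nhds ω₁, y (MilnePinney.paramT L c δ y₀ ω₀ C D (Λ ω) ω) =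
            MilnePinney.paramY L c δ y₀ C ω) ∧
          (∀ Y ∈ N, Y ≠ 0 ∧ r Y ≠ 0 ∧ r Y ^ 2 = c * Y ^ 4 - δ) ∧
          DifferentiableOn ℂ r N ∧
          MilnePinney.ChielliniOn (-2) (MilnePinney.damping δ r) (MilnePinney.restoring δ) N ∧
          ∀ t ∈ V, y t ∈ N ∧ HasDerivAt y (r (y t) / y t ^ 2) t ∧
            deriv y t ^ 2 = c - δ * (y t ^ 4)⁻¹ ∧
            MilnePinney.SolvesDampedAt δ (MilnePinney.damping δ r) y t) ∧
    -- real time: real arcs of the parametric curve solve the real equation, and every real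
    -- solution of the first-order equation is such an arc
    (∀ (c δ : ℝ) (y₀ : ℂ) (L : PeriodPair) (ω₀ : ℂ),
      δ ≠ 0 → MilnePinney.quartic c δ y₀ = 0 → MilnePinney.HasInvariants L c y₀ →
      MilnePinney.IsBasePoint L c δ y₀ ω₀ →
      (∀ (C D : ℂ) (I : Set ℝ) (Λ : ℝ → ℂ) (τ η : ℝ → ℝ), IsOpen I → IsPreconnected I →
        MilnePinney.IsRealCurve L c δ y₀ ω₀ C D I Λ τ η →
        (∀ ω ∈ I, η ω ≠ 0 ∧ c * η ω ^ 4 - δ ≠ 0) →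
        StrictMonoOn τ I ∧ IsOpen (τ '' I) ∧ ∃ ε : ℝ, (ε = 1 ∨ ε = -1) ∧
          ∀ y : ℝ → ℝ, (∀ ω ∈ I, y (τ ω) = η ω) →
            ∀ t ∈ τ '' I, 0 < c * y t ^ 4 - δ ∧
              HasDerivAt y (ε * √(c - δ * (y t ^ 4)⁻¹)) t ∧
              MilnePinney.SolvesDampedAt δ
                (MilnePinney.damping δ (fun x => ε * √(c * x ^ 4 - δ))) y t) ∧
      (∀ (ε : ℝ) (J : Set ℝ) (y : ℝ → ℝ), (ε = 1 ∨ ε = -1) → IsOpen J → IsPreconnected J →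
        (∀ t ∈ J, y t ≠ 0 ∧ 0 < c * y t ^ 4 - δ ∧
          HasDerivAt y (ε * √(c - δ * (y t ^ 4)⁻¹)) t) →
        ∃ (C D : ℂ) (I : Set ℝ) (Λ : ℝ → ℂ) (τ η : ℝ → ℝ), IsOpen I ∧ IsPreconnected I ∧
          MilnePinney.IsRealCurve L c δ y₀ ω₀ C D I Λ τ η ∧ τ '' I = J ∧
          ∀ ω ∈ I, y (τ ω) = η ω)) := by
  refine ⟨fun δ J g hδ hJ hJ' h0 hg => MilnePinney.exists_of_chielliniOn hδ hJ hJ' h0 hg,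
    fun δ c ε hδ hε => ⟨MilnePinney.chielliniOn_real hδ hε, fun J y hJ hy t ht =>
      MilnePinney.solvesDampedAt_real hε hJ hy ht⟩,
    fun c δ y₀ hδ hy => ⟨?_, fun L _ => L.exists_weierstrassP_eq _⟩,
    fun c δ y₀ L ω₀ C D U Λ hδ hy hL hb hU hΛ hlog ω₁ hω₁ hY hq =>
      MilnePinney.paramT_graph hδ hy hL hb hU hΛ hlog hω₁ hY hq,
    fun c δ y₀ L ω₀ hδ hy hL hb =>
      ⟨fun C D I Λ τ η hI hI' hcurve hη => MilnePinney.realCurve_solves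
        (Complex.ofReal_ne_zero.2 hδ) hy hL hb hI hI' hcurve hη,
      fun ε J y hε hJ hJ' hsol => MilnePinney.exists_realCurve
        (Complex.ofReal_ne_zero.2 hδ) hy hL hb hε hJ hJ' hsol⟩⟩
  obtain ⟨hc, hy0⟩ := MilnePinney.coeff_ne_zero hδ hy
  -- The invariants collapse to `g₂ = -c²y₀⁴ ≠ 0` and `g₃ = 0`, the case of the square lattice.
  obtain ⟨L, h2, h3⟩ := PeriodPair.exists_invariants (g := MilnePinney.invariantTwo c y₀) (by
    rw [MilnePinney.invariantTwo, show 3 * (c * y₀ ^ 2) ^ 2 - 4 * (c * y₀) * (c * y₀ ^ 3) =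
      -(c ^ 2 * y₀ ^ 4) by ring]
    exact neg_ne_zero.2 (mul_ne_zero (pow_ne_zero 2 hc) (pow_ne_zero 4 hy0)))
  exact ⟨L, h2, h3.trans (by rw [MilnePinney.invariantThree]; ring)⟩
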